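/- Write a real $n\times n$ matrix in block form as $A=\begin{bmatrix}\alpha & v^T\\ u & B\end{bmatrix}$ with a scalar $\alpha$. Put $A^{(1)}=A$ and let $A^{(k+1)}$ be obtained from $A^{(k)}$ by one step of Gaussian elimination without exchanges, $\begin{bmatrix}\alpha & v^T\\ u & B\end{bmatrix}\mapsto B-\frac{uv^T}{\alpha}$ (if $A^{(k)}=0$, then $A^{(k+1)}=0$). The matrix $A$ is *completely pivoted* if, for every $k$, the top left entry of $A^{(k)}$ has the largest magnitude among all entries of $A^{(k)}$. Let $A=LU$ be the factorization that the elimination produces, with $L$ unit lower triangular and $U$ upper triangular, recursively $L=\begin{bmatrix}1&0\\ u/\alpha&L_1\end{bmatrix}$, $U=\begin{bmatrix}\alpha&v^T\\0&U_1\end{bmatrix}$ with $L_1,U_1$ the factors of $B-\frac{uv^T}{\alpha}$ (and $u/\alpha$ read as $0$ if $A^{(k)}=0$). The *growth factor* of $A$ is $$g(A)=\max\left\{\|L\|_{\max},\ \frac{\|U\|_{\max}}{\|A\|_{\max}}\right\},$$ where $\|\cdot\|_{\max}$ is the largest magnitude of an entry. Consider the real $5\times5$ matrices $A$ for which there are real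 numbers $\spadesuit,\diamondsuit,\clubsuit$ such that $A^{(1)},A^{(2)},A^{(3)},A^{(4)}$ have the form $$\begin{bmatrix}1&1&*&*&*\\ *&*&*&-1&1\\ -1&*&*&-1&-1\\ *&*&1&1&1\\ *&-1&1&-1&1\end{bmatrix},\quad \begin{bmatrix}\spadesuit&*&*&*\\ \spadesuit&*&-\spadesuit&*\\ *&\spadesuit&*&*\\ -\spadesuit&*&*&*\end{bmatrix},\quad \begin{bmatrix}\diamondsuit&*&-\diamondsuit\\ \diamondsuit&*&*\\ *&-\diamondsuit&*\end{bmatrix},\quad \begin{bmatrix}\clubsuit&\clubsuit\\ -\clubsuit&\clubsuit\end{bmatrix},$$ where each $*$ is an arbitrary real number (so that the entry of $A^{(5)}$ is $2\clubsuit$). **Theorem.** The integer polynomial $P_5$ of degree $61$ displayed below has exactly one real root $g$ in the open interval $(4,5)$. This root satisfies $4.1325170786<g<4.1325170787$. Among all completely pivoted real $5\times5$ matrices of the above form, the largest growth factor exists and is equal to $g$. Here $$\begin{aligned} P_5(g)={}&-400768351683901408958416200638054732473753927680 +4485865416851125743788230145233574388718469382144g \\ &-24514764764411504983475981567602588918013382098944g^{2}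 +87217226729799564487654554570961532637620826275840g^{3} \\ &-227272096308101830763401243729746552751035059798016g^{4} +462709819431332579135613503090210881152929786494976g^{5} \\ &-766717614581304313114392121166832616680006210289664g^{6} +1063584436778076241182112335678621890599851466424320g^{7} \\ &-1260890928707415271320049672620311457803946132766720g^{8} +1297738577606655379676433338360545479999727889022976g^{9} \\ &-1174034757320339655369158795901049591606791293108224g^{10} +942963464577089526044422206269395994977092205805568g^{11} \\ &-677934188506657333601022620611924661223810387673088g^{12} +439257245648213960218425406267346647338070336077824g^{13} \\ &-257972856502979631073226298004753211978646395289600g^{14} +137990608561232610866439277823535118550017691877376g^{15} \\ &-67501782245716434625321022717049489901181623861248g^{16} +30300948936890380444641188810690357840398421852160g^{17} \\ &-12517004528640474114410312100200354935951234957312g^{18} +4769063904740641993461152447863884474835999391744g^{19} \\ &-1678801195187379807996886928950958962405971853312g^{20} +546626688596819879421936148562972655095260381184g^{21} \\ &-164708488081737671005260911304389856200929312768g^{22} +45913441353285356544812597189623621359713124352g^{23} \\ &-11824394908442237813782015042429910964838072320g^{24} +2805505141981336865142529528869875207720927232g^{25} \\ &-610122837879497813508978054510894441606152192g^{26} +120517644367496052573488222809065538013102080g^{27}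 \\ &-21259613889629901444312810746680889153945600g^{28} +3232473902649233225492038672001558428778496g^{29} \\ &-385658581119287455693748758468032752254976g^{30} +22806308021126342831010091967753643622400g^{31} \\ &+4894535361089103056466100216447232901120g^{32} -2321369271980741328279078542236324986880g^{33} \\ &+601696561599723882176326969201384226816g^{34} -123775438994232337878919408695562469376g^{35} \\ &+21961720969887997312065520856381521920g^{36} -3468454832875402800794241505433747456g^{37} \\ &+494585628535060280610858619094695936g^{38} -64096987281967089485798296793382912g^{39} \\ &+7566621187666403129807306257072128g^{40} -812991033858742708150732650971136g^{41} \\ &+79218174622382297258263303946240g^{42} -6951821319653222073914715275264g^{43} \\ &+542828623292663115763310526464g^{44} -36902811774200980940618924032g^{45} \\ &+2088035191940616804066754560g^{46} -86850177265000967745748992g^{47} \\ &+1176129227591098999291904g^{48} +223725965850750547116032g^{49} \\ &-29310655078216507848704g^{50} +2327920657178572930048g^{51} \\ &-143068110048321554432g^{52} +7211069563930583552g^{53} \\ &-302975406829565568g^{54} +10602327706308288g^{55} \\ &-305386806375072g^{56} +7079217962544g^{57} \\ &-127283265864g^{58} +1668783060g^{59} \\ &-14211126g^{60} +59049g^{61}.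 \end{aligned}$$ -/

import Mathlib

/-- The largest magnitude of an entry of a square matrix. -/
noncomputable def maxNorm {n : ℕ} (A : Matrix (Fin n) (Fin n) ℝ) : ℝ :=
  ⨆ p : Fin n × Fin n, |A p.1 p.2|

/-- One step of Gaussian elimination without any exchange of rows or columns: the Schur complement
`B - x yᵀ / α` of the pivot `α` in the block matrix `[α, yᵀ; x, B]`. So if `A⁽¹⁾ = A`, then
`A⁽ᵏ⁺¹⁾ = elimStep A⁽ᵏ⁾`, with rows and columns numbered from `0`.
If `α = 0` the division convention makes this `B`; for the completely pivoted matrices below, the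
pivot `α` vanishes only if the whole matrix does, and then the elimination step gives `0`. -/
noncomputable def elimStep {n : ℕ} (A : Matrix (Fin (n + 1)) (Fin (n + 1)) ℝ) :
    Matrix (Fin n) (Fin n) ℝ :=
  Matrix.of fun i j => A i.succ j.succ - A i.succ 0 * A 0 j.succ / A 0 0

/-- The unit lower triangular factor `[1, 0; x / α, L₁]` of Gaussian elimination, where `L₁` is the
corresponding factor of the Schur complement. -/
noncomputable def lowerFactor : {n : ℕ} → Matrix (Fin n) (Fin n) ℝ → Matrix (Fin n) (Fin n) ℝ
  | 0, A => A
  | _ + 1, A => Matrix.of (Fin.cons (Fin.cons 1 0)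
      fun i => Fin.cons (A i.succ 0 / A 0 0) (lowerFactor (elimStep A) i))

/-- The upper triangular factor `[α, yᵀ; 0, U₁]` of Gaussian elimination, where `U₁` is the
corresponding factor of the Schur complement. -/
noncomputable def upperFactor : {n : ℕ} → Matrix (Fin n) (Fin n) ℝ → Matrix (Fin n) (Fin n) ℝ
  | 0, A => A
  | _ + 1, A => Matrix.of (Fin.cons (A 0)
      fun i => Fin.cons 0 (upperFactor (elimStep A) i))

/-- The growth factor `max (‖L‖_max) (‖U‖_max / ‖A‖_max)`. -/
noncomputable def growthFactor {n : ℕ} (A : Matrix (Fin n) (Fin n) ℝ) : ℝ :=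
  max (maxNorm (lowerFactor A)) (maxNorm (upperFactor A) / maxNorm A)

/-- `A` is completely pivoted: in each of `A⁽¹⁾, A⁽²⁾, …` the top left entry has the largest
magnitude. -/
def CompletelyPivoted : {n : ℕ} → Matrix (Fin n) (Fin n) ℝ → Prop
  | 0, _ => True
  | _ + 1, A => (∀ i j, |A i j| ≤ |A 0 0|) ∧ CompletelyPivoted (elimStep A)

/-- The equality constraints
```
 1  1  *  *  *
 *  *  * -1  1      ♠  *  *  *
-1  *  * -1 -1      ♠  * -♠  *      ♦  * -♦
 *  *  1  1  1      *  ♠  *  *      ♦  *  *      ♣  ♣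
 * -1  1 -1  1     -♠  *  *  *      * -♦  *     -♣  ♣
```
on `A⁽¹⁾`, `A⁽²⁾`, `A⁽³⁾`, `A⁽⁴⁾`. In each of the last three the suit is the value of the top left
entry, and a star stands for an unconstrained entry. (The single entry of `A⁽⁵⁾` is then `2♣`.) -/
structure SuitPattern (A : Matrix (Fin 5) (Fin 5) ℝ) : Prop where
  row1 : A 0 0 = 1 ∧ A 0 1 = 1
  row2 : A 1 3 = -1 ∧ A 1 4 = 1
  row3 : A 2 0 = -1 ∧ A 2 3 = -1 ∧ A 2 4 = -1
  row4 : A 3 2 = 1 ∧ A 3 3 = 1 ∧ A 3 4 = 1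
  row5 : A 4 1 = -1 ∧ A 4 2 = 1 ∧ A 4 3 = -1 ∧ A 4 4 = 1
  spade1 : elimStep A 1 0 = elimStep A 0 0
  spade2 : elimStep A 1 2 = -elimStep A 0 0
  spade3 : elimStep A 2 1 = elimStep A 0 0
  spade4 : elimStep A 3 0 = -elimStep A 0 0
  diamond1 : elimStep (elimStep A) 0 2 = -elimStep (elimStep A) 0 0
  diamond2 : elimStep (elimStep A) 1 0 = elimStep (elimStep A) 0 0
  diamond3 : elimStep (elimStep A) 2 1 = -elimStep (elimStep A) 0 0
  club1 : elimStep (elimStep (elimStep A)) 0 1 = elimStep (elimStep (elimStep A)) 0 0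
  club2 : elimStep (elimStep (elimStep A)) 1 0 = -elimStep (elimStep (elimStep A)) 0 0
  club3 : elimStep (elimStep (elimStep A)) 1 1 = elimStep (elimStep (elimStep A)) 0 0

/-- The coefficients of `1, g, g², …, g⁶¹` in the polynomial `P5`, in this order. -/
def P5Coeffs : List ℤ :=
  [-400768351683901408958416200638054732473753927680,
   4485865416851125743788230145233574388718469382144,
   -24514764764411504983475981567602588918013382098944,
   87217226729799564487654554570961532637620826275840,
   -227272096308101830763401243729746552751035059798016,
   462709819431332579135613503090210881152929786494976,
   -766717614581304313114392121166832616680006210289664,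
   1063584436778076241182112335678621890599851466424320,
   -1260890928707415271320049672620311457803946132766720,
   1297738577606655379676433338360545479999727889022976,
   -1174034757320339655369158795901049591606791293108224,
   942963464577089526044422206269395994977092205805568,
   -677934188506657333601022620611924661223810387673088,
   439257245648213960218425406267346647338070336077824,
   -257972856502979631073226298004753211978646395289600,
   137990608561232610866439277823535118550017691877376,
   -67501782245716434625321022717049489901181623861248,
   30300948936890380444641188810690357840398421852160,
   -12517004528640474114410312100200354935951234957312,
   4769063904740641993461152447863884474835999391744,
   -1678801195187379807996886928950958962405971853312,
   546626688596819879421936148562972655095260381184,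
   -164708488081737671005260911304389856200929312768,
   45913441353285356544812597189623621359713124352,
   -11824394908442237813782015042429910964838072320,
   2805505141981336865142529528869875207720927232,
   -610122837879497813508978054510894441606152192,
   120517644367496052573488222809065538013102080,
   -21259613889629901444312810746680889153945600,
   3232473902649233225492038672001558428778496,
   -385658581119287455693748758468032752254976,
   22806308021126342831010091967753643622400,
   4894535361089103056466100216447232901120,
   -2321369271980741328279078542236324986880,
   601696561599723882176326969201384226816,
   -123775438994232337878919408695562469376,
   21961720969887997312065520856381521920,
   -3468454832875402800794241505433747456,
   494585628535060280610858619094695936,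
   -64096987281967089485798296793382912,
   7566621187666403129807306257072128,
   -812991033858742708150732650971136,
   79218174622382297258263303946240,
   -6951821319653222073914715275264,
   542828623292663115763310526464,
   -36902811774200980940618924032,
   2088035191940616804066754560,
   -86850177265000967745748992,
   1176129227591098999291904,
   223725965850750547116032,
   -29310655078216507848704,
   2327920657178572930048,
   -143068110048321554432,
   7211069563930583552,
   -302975406829565568,
   10602327706308288,
   -305386806375072,
   7079217962544,
   -127283265864,
   1668783060,
   -14211126,
   59049]

open Polynomial in
/-- The polynomial `c₀ + c₁ X + ⋯ + c₆₁ X⁶¹` of degree `61` with the integer coefficients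
`P5Coeffs = [c₀, …, c₆₁]`. -/
noncomputable def P5 : ℤ[X] :=
  P5Coeffs.foldr (fun c p => C c + X * p) 0

section CoefficientLists

variable {R : Type*} [CommRing R]

/-- The value at `x` of the polynomial with coefficients `p`, constant term first. -/
def evalL : List ℤ → R → R
  | [], _ => 0
  | c :: p, x => c + x * evalL p x

@[simp] theorem evalL_nil (x : R) : evalL [] x = 0 := rfl

@[simp] theorem evalL_cons (c : ℤ) (p : List ℤ) (x : R) :
    evalL (c :: p) x = c + x * evalL p x := rfl

/-- `evalL` over the integers, in a form that the kernel evaluates quickly. -/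
def evalZ : List ℤ → ℤ → ℤ
  | [], _ => 0
  | c :: p, x => Int.add c (Int.mul x (evalZ p x))

theorem evalZ_eq (p : List ℤ) (x : ℤ) : evalZ p x = evalL p x := by
  induction p with
  | nil => rfl
  | cons c p ih =>
    rw [evalZ, ih, evalL_cons]
    rfl

/-- The sum of the coefficients of two polynomials. -/
def addL : List ℤ → List ℤ → List ℤ
  | [], q => q
  | a :: p, [] => a :: p
  | a :: p, b :: q => (a + b) :: addL p q

/-- A constant multiple of a polynomial. -/
def smulL (a : ℤ) (p : List ℤ) : List ℤ := p.map (a * ·)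

/-- The product of two polynomials. -/
def mulL : List ℤ → List ℤ → List ℤ
  | [], _ => []
  | a :: p, q => addL (smulL a q) (0 :: mulL p q)

/-- A power of a polynomial. -/
def powL (p : List ℤ) : ℕ → List ℤ
  | 0 => [1]
  | n + 1 => mulL (powL p n) p

@[simp] theorem evalL_addL (p q : List ℤ) (x : R) :
    evalL (addL p q) x = evalL p x + evalL q x := by
  induction p generalizing q with
  | nil => simp [addL]
  | cons a p ih =>
    cases q with
    | nil => simp [addL]
    | cons b q =>
      simp only [addL, evalL_cons, ih]
      push_cast
      ring

@[simp] theorem evalL_smulL (a : ℤ) (p : List ℤ) (x : R) :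
    evalL (smulL a p) x = a * evalL p x := by
  induction p with
  | nil => simp [smulL]
  | cons b p ih =>
    simp only [smulL, List.map_cons, evalL_cons] at ih ⊢
    rw [ih]
    push_cast
    ring

@[simp] theorem evalL_mulL (p q : List ℤ) (x : R) :
    evalL (mulL p q) x = evalL p x * evalL q x := by
  induction p with
  | nil => simp [mulL]
  | cons a p ih =>
    simp only [mulL, evalL_addL, evalL_smulL, evalL_cons, ih]
    push_cast
    ring

@[simp] theorem evalL_powL (p : List ℤ) (n : ℕ) (x : R) :
    evalL (powL p n) x = evalL p x ^ n := by
  induction n with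
  | zero => simp [powL]
  | succ n ih => simp [powL, ih, pow_succ]

/-- The sum of the magnitudes of the coefficients. -/
def normL : List ℤ → ℕ
  | [] => 0
  | a :: p => a.natAbs + normL p

theorem normL_addL_le (p q : List ℤ) : normL (addL p q) ≤ normL p + normL q := by
  induction p generalizing q with
  | nil => simp [addL, normL]
  | cons a p ih =>
    cases q with
    | nil => simp [addL, normL]
    | cons b q =>
      have := ih q
      have := Int.natAbs_add_le a b
      simp only [addL, normL]
      omega

theorem normL_smulL (a : ℤ) (p : List ℤ) : normL (smulL a p) = a.natAbs * normL p := by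
  induction p with
  | nil => simp [smulL, normL]
  | cons b p ih =>
    simp only [smulL, List.map_cons, normL] at ih ⊢
    rw [ih, Int.natAbs_mul]
    ring

theorem normL_mulL_le (p q : List ℤ) : normL (mulL p q) ≤ normL p * normL q := by
  induction p with
  | nil => simp [mulL, normL]
  | cons a p ih =>
    refine (normL_addL_le _ _).trans ?_
    rw [normL_smulL]
    simp only [normL, Int.natAbs_zero, zero_add, add_mul]
    omega

theorem normL_powL_le (p : List ℤ) (n : ℕ) : normL (powL p n) ≤ normL p ^ n := by
  induction n with
  | zero => simp [powL, normL]
  | succ n ih =>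
    rw [pow_succ]
    exact (normL_mulL_le _ _).trans (Nat.mul_le_mul_right _ ih)

/-- A polynomial with a root `X` that exceeds its coefficients vanishes. -/
theorem evalL_eq_zero_of_normL_lt (p : List ℤ) {X : ℕ} (hp : normL p < X)
    (h : evalL p (X : ℤ) = 0) (x : R) : evalL p x = 0 := by
  induction p with
  | nil => simp
  | cons c p ih =>
    simp only [normL] at hp
    rw [evalL_cons, Int.cast_id] at h
    have hc : c = 0 := by
      refine Int.eq_zero_of_abs_lt_dvd (m := (X : ℤ)) ⟨-evalL p (X : ℤ), by linarith⟩ ?_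
      rw [Int.abs_eq_natAbs]
      omega
    subst hc
    have hX : X ≠ 0 := by omega
    rw [evalL_cons, ih (by omega) (by simpa [hX] using h)]
    simp

/-- Two polynomials that agree at a point exceeding their coefficients are equal. -/
theorem evalL_eq_of_normL_lt (p q : List ℤ) {X : ℕ} (hpq : normL p + normL q < X)
    (h : evalL p (X : ℤ) = evalL q (X : ℤ)) (x : R) : evalL p x = evalL q x := by
  have key := evalL_eq_zero_of_normL_lt (addL p (smulL (-1) q)) (X := X) ?_ ?_ x
  · rw [evalL_addL, evalL_smulL] at key
    push_cast at key
    linear_combination key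
  · refine (normL_addL_le _ _).trans_lt ?_
    rw [normL_smulL]
    simpa using hpq
  · rw [evalL_addL, evalL_smulL, h]
    push_cast
    ring

/-- Whether `y` has at most `n` digits in base `X`, all of them at most `C`. -/
def digitsLe (X C : ℕ) : ℕ → ℕ → Bool
  | 0, y => Nat.beq y 0
  | n + 1, y => (Nat.ble (y % X) C).and (digitsLe X C n (y / X))

theorem exists_evalL_eq_of_digitsLe {X C : ℕ} (n y : ℕ) (h : digitsLe X C n y = true) :
    ∃ Q : List ℤ, (∀ c ∈ Q, 0 ≤ c) ∧ Q.length = n ∧ normL Q ≤ n * C ∧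
      evalL Q (X : ℤ) = y := by
  induction n generalizing y with
  | zero =>
    refine ⟨[], by simp, rfl, by simp [normL], ?_⟩
    simp [Nat.eq_of_beq_eq_true h]
  | succ n ih =>
    rw [digitsLe, Bool.and_eq_true] at h
    obtain ⟨Q, hQ, hl, hn, he⟩ := ih _ h.2
    have hle : y % X ≤ C := Nat.le_of_ble_eq_true h.1
    refine ⟨((y % X : ℕ) : ℤ) :: Q, ?_, by simp [hl], ?_, ?_⟩
    · intro c hc
      rcases List.mem_cons.1 hc with rfl | hc
      · positivity
      · exact hQ c hc
    · simp only [normL, Int.natAbs_natCast]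
      rw [Nat.succ_mul]
      omega
    · rw [evalL_cons, he, Int.cast_id]
      exact_mod_cast Nat.mod_add_div y X

theorem normL_replicate (n : ℕ) (C : ℕ) : normL (List.replicate n (C : ℤ)) = n * C := by
  induction n with
  | zero => simp [normL]
  | succ n ih =>
    rw [List.replicate_succ, normL, ih, Int.natAbs_natCast]
    ring

/-- If `y + ∑ i < n, C * X ^ i` has small digits in base `X`, then the integer `y` is the value
at `X` of a polynomial with small coefficients. -/
theorem exists_evalL_eq_of_digitsLe_add {X C : ℕ} (n : ℕ) (y : ℤ)
    (h : digitsLe X (2 * C) n (Int.toNat (Int.add y (evalZ (List.replicate n (C : ℤ)) X))) = true)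
    (h0 : Int.le 0 (Int.add y (evalZ (List.replicate n (C : ℤ)) X))) :
    ∃ Q : List ℤ, normL Q ≤ 3 * (n * C) ∧ evalL Q (X : ℤ) = y := by
  obtain ⟨Q, -, -, hn, he⟩ := exists_evalL_eq_of_digitsLe _ _ h
  refine ⟨addL Q (smulL (-1) (List.replicate n (C : ℤ))), ?_, ?_⟩
  · refine (normL_addL_le _ _).trans ?_
    rw [normL_smulL, normL_replicate]
    simp only [Int.reduceNeg, Int.natAbs_neg, Int.natAbs_one, one_mul]
    nlinarith
  · rw [evalL_addL, evalL_smulL, he, Int.toNat_of_nonneg h0, evalZ_eq]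
    change y + evalL _ (X : ℤ) + _ = _
    push_cast
    ring

theorem evalL_nonneg {p : List ℤ} (hp : ∀ c ∈ p, 0 ≤ c) {x : ℝ} (hx : 0 ≤ x) : 0 ≤ evalL p x := by
  induction p with
  | nil => simp
  | cons c p ih =>
    have hc : (0 : ℝ) ≤ c := by exact_mod_cast hp c (by simp)
    rw [evalL_cons]
    exact add_nonneg hc (mul_nonneg hx (ih fun c hc => hp c (by simp [hc])))

/-- A polynomial with nonnegative coefficients that is positive at one positive point is positive at
all positive points. -/
theorem evalL_pos_of_pos {p : List ℤ} (hp : ∀ c ∈ p, 0 ≤ c) {X : ℤ} (hX : 0 < X)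
    (h : 0 < evalL p X) {x : ℝ} (hx : 0 < x) : 0 < evalL p x := by
  induction p with
  | nil => simp at h
  | cons c p ih =>
    have hp' : ∀ c ∈ p, 0 ≤ c := fun c hc => hp c (by simp [hc])
    rw [evalL_cons]
    rcases (hp c (by simp)).lt_or_eq with hc | rfl
    · exact add_pos_of_pos_of_nonneg (by exact_mod_cast hc) (mul_nonneg hx.le (evalL_nonneg hp' hx.le))
    · rw [evalL_cons, Int.cast_zero, zero_add] at h
      simpa using mul_pos hx (ih hp' (pos_of_mul_pos_right h hX.le))

/-- The value of a polynomial whose coefficients are found to be nonnegative from its value at a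
large number is positive. -/
theorem evalL_pos_of_digitsLe (p : List ℤ) {X C n : ℕ} (hX : normL p + n * C < X)
    (h0 : 0 < evalL p (X : ℤ)) (h : digitsLe X C n (Int.toNat (evalL p (X : ℤ))) = true)
    {x : ℝ} (hx : 0 < x) : 0 < evalL p x := by
  obtain ⟨Q, hQ, -, hn, he⟩ := exists_evalL_eq_of_digitsLe _ _ h
  rw [Int.toNat_of_nonneg h0.le] at he
  rw [evalL_eq_of_normL_lt p Q (X := X) (by omega) he.symm x]
  exact evalL_pos_of_pos hQ (by omega) (he ▸ h0) hx

end CoefficientLists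

section Mobius

/-- The polynomial `(q (1 + t)) ^ n * p ((a + b t) / (q (1 + t)))` in `t`, where `n` is the number of
coefficients of `p`. -/
def mobL (a b q : ℤ) : List ℤ → List ℤ
  | [] => []
  | c :: p => addL (smulL c (powL [q, q] (p.length + 1))) (mulL [a, b] (mobL a b q p))

/-- The value of `mobL a b q p` at `x`. -/
def mobZ (a b q x : ℤ) : List ℤ → ℤ
  | [] => 0
  | c :: p => Int.add (Int.mul c (Int.pow (Int.add q (Int.mul x q)) (p.length + 1)))
      (Int.mul (Int.add a (Int.mul x b)) (mobZ a b q x p))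

/-- A bound for the coefficients of `mobL a b q p`. -/
def mobN (a b q : ℤ) : List ℤ → ℕ
  | [] => 0
  | c :: p => c.natAbs * (2 * q.natAbs) ^ (p.length + 1) + (a.natAbs + b.natAbs) * mobN a b q p

theorem mobZ_eq (a b q x : ℤ) (p : List ℤ) : mobZ a b q x p = evalL (mobL a b q p) x := by
  induction p with
  | nil => simp [mobZ, mobL]
  | cons c p ih =>
    rw [mobZ, mobL, evalL_addL, evalL_smulL, evalL_powL, evalL_mulL, ih]
    simp only [evalL_cons, evalL_nil, mul_zero, add_zero, Int.cast_id]
    rfl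

theorem normL_mobL_le (a b q : ℤ) (p : List ℤ) : normL (mobL a b q p) ≤ mobN a b q p := by
  induction p with
  | nil => simp [mobN, mobL, normL]
  | cons c p ih =>
    refine (normL_addL_le _ _).trans (add_le_add ?_ ((normL_mulL_le _ _).trans ?_))
    · rw [normL_smulL]
      refine Nat.mul_le_mul_left _ ((normL_powL_le _ _).trans (le_of_eq ?_))
      congr 1
      simp only [normL]
      ring
    · refine (Nat.mul_le_mul_left _ ih).trans (le_of_eq ?_)
      simp [normL]

theorem evalL_mobL (a b q : ℤ) (p : List ℤ) {t x : ℝ} (h : (q * (1 + t)) * x = a + b * t) :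
    evalL (mobL a b q p) t = (q * (1 + t)) ^ p.length * evalL p x := by
  induction p with
  | nil => simp [mobL]
  | cons c p ih =>
    rw [mobL, evalL_addL, evalL_smulL, evalL_powL, evalL_mulL, ih]
    simp only [evalL_cons, evalL_nil, mul_zero, add_zero, List.length_cons]
    rw [show (q + t * q : ℝ) = q * (1 + t) by ring, mul_comm t, ← h]
    ring

/-- A sufficient check for positivity of `p` on the interval from `a / q` to `b / q`. -/
def posCheck (a b q : ℤ) (X C : ℕ) (p : List ℤ) : Bool :=
  (Nat.ble (mobN a b q p + (p.length + 1) * C + 1) X).and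
    ((Nat.ble 1 (Int.toNat (mobZ a b q X p))).and
      (digitsLe X C (p.length + 1) (Int.toNat (mobZ a b q X p))))

theorem evalL_pos_of_posCheck {a b q : ℤ} {X C : ℕ} {p : List ℤ} (h : posCheck a b q X C p = true)
    (hq : 0 < q) {x : ℝ} (hax : a < q * x) (hxb : q * x < b) : 0 < evalL p x := by
  rw [posCheck, Bool.and_eq_true, Bool.and_eq_true, mobZ_eq] at h
  obtain ⟨h1, h2, h3⟩ := h
  have h1 := Nat.le_of_ble_eq_true h1
  have h2 := Nat.le_of_ble_eq_true h2
  have hN := normL_mobL_le a b q p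
  have hq' : (0 : ℝ) < q := by exact_mod_cast hq
  have hbx : (0 : ℝ) < b - q * x := by linarith
  have hab : (0 : ℝ) < b - a := by linarith
  set t : ℝ := (q * x - a) / (b - q * x) with ht
  have ht0 : 0 < t := div_pos (by linarith) hbx
  have htx : (q * (1 + t)) * x = a + b * t := by
    rw [ht]
    field_simp
    ring
  have key := evalL_pos_of_digitsLe (mobL a b q p) (X := X) (C := C) (n := p.length + 1) (by omega)
    (by omega) h3 ht0
  rw [evalL_mobL a b q p htx] at key
  exact pos_of_mul_pos_right key (by positivity)

end Mobius

section Divisibility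

/-- The polynomial `∑ i < n, cᵢ N ^ i D ^ (n - 1 - i)`, where `c₀, …, cₙ₋₁` are polynomials. -/
def homL (N D : List ℤ) : List (List ℤ) → List ℤ
  | [] => []
  | c :: p => addL (mulL c (powL D p.length)) (mulL N (homL N D p))

/-- The value of `homL N D p` at `x`, for values `N` and `D`. -/
def homZ (N D x : ℤ) : List (List ℤ) → ℤ
  | [] => 0
  | c :: p => Int.add (Int.mul (evalZ c x) (Int.pow D p.length)) (Int.mul N (homZ N D x p))

/-- A bound for the coefficients of `homL N D p`, for bounds `N` and `D`. -/
def homN (N D : ℕ) : List (List ℤ) → ℕ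
  | [] => 0
  | c :: p => normL c * D ^ p.length + N * homN N D p

/-- The value at `y` of a polynomial whose coefficients are polynomials evaluated at `x`. -/
def evalLL : List (List ℤ) → ℝ → ℝ → ℝ
  | [], _, _ => 0
  | c :: p, x, y => evalL c x + y * evalLL p x y

theorem homZ_eq (N D : List ℤ) (x : ℤ) (p : List (List ℤ)) :
    homZ (evalZ N x) (evalZ D x) x p = evalL (homL N D p) x := by
  induction p with
  | nil => rfl
  | cons c p ih =>
    rw [homZ, ih, homL, evalL_addL, evalL_mulL, evalL_mulL, evalL_powL]
    simp only [evalZ_eq]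
    rfl

theorem normL_homL_le (N D : List ℤ) (p : List (List ℤ)) :
    normL (homL N D p) ≤ homN (normL N) (normL D) p := by
  induction p with
  | nil => simp [homN, homL, normL]
  | cons c p ih =>
    refine (normL_addL_le _ _).trans (add_le_add ?_ ?_)
    · exact (normL_mulL_le _ _).trans (Nat.mul_le_mul_left _ (normL_powL_le _ _))
    · exact (normL_mulL_le _ _).trans (Nat.mul_le_mul_left _ ih)

theorem evalL_homL (N D : List ℤ) (p : List (List ℤ)) {x y : ℝ}
    (h : evalL D x * y = evalL N x) :
    evalL (homL N D p) x * evalL D x = evalL D x ^ p.length * evalLL p x y := by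
  induction p with
  | nil => simp [homL, evalLL]
  | cons c p ih =>
    rw [homL, evalL_addL, evalL_mulL, evalL_mulL, evalL_powL, evalLL, List.length_cons, add_mul,
      mul_assoc (evalL N x), ih, ← h]
    ring

/-- A sufficient check for the divisibility of `homL N D p` by `P`. -/
noncomputable def dvdCheck (N D P : List ℤ) (X C n : ℕ) (p : List (List ℤ)) : Bool :=
  (Nat.ble (homN (normL N) (normL D) p + 3 * (n * C) * normL P + 1) X).and
    ((Int.beq' (homZ (evalZ N X) (evalZ D X) X p)
      (Int.mul (Int.tdiv (homZ (evalZ N X) (evalZ D X) X p) (evalZ P X)) (evalZ P X))).and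
    ((Nat.ble 1 (Int.toNat (Int.add (Int.tdiv (homZ (evalZ N X) (evalZ D X) X p) (evalZ P X))
      (evalZ (List.replicate n (C : ℤ)) X)))).and
      (digitsLe X (2 * C) n
        (Int.toNat (Int.add (Int.tdiv (homZ (evalZ N X) (evalZ D X) X p) (evalZ P X))
          (evalZ (List.replicate n (C : ℤ)) X))))))

theorem evalLL_eq_zero_of_dvdCheck {N D P : List ℤ} {X C n : ℕ} {p : List (List ℤ)}
    (h : dvdCheck N D P X C n p = true) {x y : ℝ} (hP : evalL P x = 0) (hD : evalL D x ≠ 0)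
    (hy : evalL D x * y = evalL N x) : evalLL p x y = 0 := by
  rw [dvdCheck, Bool.and_eq_true, Bool.and_eq_true, Bool.and_eq_true] at h
  obtain ⟨h1, h2, h3, h4⟩ := h
  have h1 := Nat.le_of_ble_eq_true h1
  have h3 := Nat.le_of_ble_eq_true h3
  have h2 := (Int.beq'_eq _ _).mp h2
  obtain ⟨Q, hQ, he⟩ := exists_evalL_eq_of_digitsLe_add n _ h4 (by
    change (0 : ℤ) ≤ _
    omega)
  rw [← he, homZ_eq, evalZ_eq P] at h2
  have hle : normL (mulL Q P) ≤ 3 * (n * C) * normL P :=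
    (normL_mulL_le _ _).trans (Nat.mul_le_mul_right _ hQ)
  have hN := normL_homL_le N D p
  have key := evalL_eq_of_normL_lt (homL N D p) (mulL Q P) (X := X) (by omega)
    (by rw [h2, evalL_mulL]; rfl) x
  have h0 := evalL_homL N D p hy
  rw [key, evalL_mulL, hP, mul_zero, zero_mul] at h0
  exact (mul_eq_zero.1 h0.symm).resolve_left (pow_ne_zero _ hD)

end Divisibility

/-- The derivative of a polynomial. -/
def derivL : List ℤ → List ℤ
  | [] => []
  | _ :: p => addL p (0 :: derivL p)

/-- The sum of two polynomials whose coefficients are polynomials. -/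
def addLL : List (List ℤ) → List (List ℤ) → List (List ℤ)
  | [], q => q
  | a :: p, [] => a :: p
  | a :: p, b :: q => addL a b :: addLL p q

/-- The derivative of a polynomial whose coefficients are polynomials. -/
def derivLL : List (List ℤ) → List (List ℤ)
  | [] => []
  | _ :: p => addLL p ([] :: derivLL p)

theorem evalLL_addLL (p q : List (List ℤ)) (x y : ℝ) :
    evalLL (addLL p q) x y = evalLL p x y + evalLL q x y := by
  induction p generalizing q with
  | nil => simp [addLL, evalLL]
  | cons a p ih =>
    cases q with
    | nil => simp [addLL, evalLL]
    | cons b q =>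
      simp only [addLL, evalLL, ih, evalL_addL]
      ring

theorem hasDerivAt_evalL (p : List ℤ) (x : ℝ) : HasDerivAt (evalL p) (evalL (derivL p) x) x := by
  induction p with
  | nil => exact hasDerivAt_const x 0
  | cons c p ih =>
    rw [derivL, evalL_addL, evalL_cons, Int.cast_zero, zero_add]
    have := ((hasDerivAt_id x).mul ih).const_add (c : ℝ)
    rwa [id, one_mul] at this

theorem hasDerivAt_evalLL (p : List (List ℤ)) (x y : ℝ) :
    HasDerivAt (evalLL p x) (evalLL (derivLL p) x y) y := by
  induction p with
  | nil => exact hasDerivAt_const y 0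
  | cons c p ih =>
    rw [derivLL, evalLL_addLL, evalLL, evalL_nil, zero_add]
    have := ((hasDerivAt_id y).mul ih).const_add (evalL c x)
    rwa [id, one_mul] at this

/-- The coefficients of a polynomial `N` such that `N(g) / (30 P5'(g))` is, for each root `g` of `P5`,
a double root of the polynomial with coefficients `curveCoeffs` evaluated at `g`. -/
def rootNumCoeffs : List ℤ :=
  [8347136673595136389177024199539523652960129122304,
   -87388359786827482344135054867519366890667947065344,
   446744374854574438327924444546838076017729465221120,
   -1486990522600826241762751165182976423095663618686976,
   3625467142409321020865101928552134665467339300929536,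
   -6906602656982906639777721206385898697245299241385984,
   10709069835249122887718723743509032810158274180546560,
   -13902233603548128251302166229115316361879124201963520,
   15426332730918855575814508147727037378555326219943936,
   -14866327403486465215546250782872317729387549141499904,
   12601747547507128596469996076767251855615292193374208,
   -9495292774896998351707794326880790260528064011173888,
   6417094149359392795983851994213971114517734184976384,
   -3920805361107587552033504987765227293200587790745600,
   2181671167922063260046812372208975562789782349152256,
   -1113249952549527076972800517797974506222183826587648,
   524480740638911363681071030983057201767214512865280,
   -229678847046553072893311622802284831883842889449472,
   94113122598181220715514106692301185096250644496384,
   -36313860296688336073407405959021085166338857500672,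
   13269397940233660998566415562592951099255102111744,
   -4612655660195023482914747165026969811298725920768,
   1529855719739176589408828922131225534306768125952,
   -484674025568573566342507632652627287518887280640,
   146593772783368483998221213250323846929865244672,
   -42252078412496061968649159706110264503993106432,
   11574646053555539676213185679547280550401146880,
   -3004890034006897008412427043354961162524426240,
   737179366609943369612777017687852645263343616,
   -170457305726491487653621861101725798792953856,
   37065125452031109431398984212663372454297600,
   -7564010177576110153079072507405367508992000,
   1446065170884038977583956192147624238776320,
   -258536651866857951591015037192398128021504,
   43151133658759845302506160813009434312704,
   -6710776926055168171793153356779371888640,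
   970334435701343956582179086193943117824,
   -130111247263437739523799085513172844544,
   16127457678872027717290967014632849408,
   -1840363598095423506437502343789412352,
   192300713111028448870901587953844224,
   -18261505833820860814183905330462720,
   1558609544431961127554680074797056,
   -117414783552872983202487218733056,
   7547025514630323845921259061248,
   -381927282750747285210642513920,
   11049732158526417988509974528,
   445228990189784518433112064,
   -102399692144393899092123648,
   9957720251603260067332096,
   -714870523277270660621312,
   41701092336614100748288,
   -2034227724520139045888,
   83524208211694144512,
   -2872408602539224512,
   81608970375203328,
   -1871188953384816,
   33356101651776,
   -434567149740,
   3685996044,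
   -15293691]

/-- The coefficients of `30 P5'`. -/
def rootDenCoeffs : List ℤ := smulL 30 (derivL P5Coeffs)

/-- The coefficients of `1, w, …, w¹⁰` in `4⁷` times the equation of the curve, as polynomials in
`g = 4 h`. -/
def curveCoeffs : List (List ℤ) :=
  [[-2097152, 3670016, -2621440, 983040, -204800, 22528, -1024, 0],
   [7340032, -11534336, 7077888, -2097152, 274432, 0, -3584, 256],
   [262144, -1900544, 2736128, -1658880, 516096, -86528, 7424, -256],
   [-19529728, 26279936, -13443072, 2945024, -92160, -75008, 12672, -640],
   [2752512, 2146304, -5967872, 3796992, -1142784, 182784, -15104, 512],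
   [20660224, -22298624, 7757824, -120320, -580608, 153408, -16384, 656],
   [4784128, -12689408, 11046912, -4667904, 1086720, -143552, 10176, -304],
   [-6782976, 1867776, 3489792, -2678784, 823808, -130688, 10624, -352],
   [-7208960, 9437184, -5206016, 1542144, -264192, 26240, -1408, 32],
   [-4177920, 6864896, -4603904, 1648128, -343552, 42048, -2816, 80],
   [-983040, 1564672, -1019904, 356864, -72960, 8768, -576, 16]]

/-- The coefficients of `1, h, …, h⁷` in the equation of the curve, as polynomials in `w`. -/
def curveCoeffsH : List (List ℤ) :=
  [[-128, 448, 16, -1192, 168, 1261, 292, -414, -440, -255, -60],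
   [896, -2816, -464, 6416, 524, -5444, -3098, 456, 2304, 1676, 382],
   [-2560, 6912, 2672, -13128, -5828, 7576, 10788, 3408, -5084, -4496, -996],
   [3840, -8192, -6480, 11504, 14832, -470, -18234, -10464, 6024, 6438, 1394],
   [-3200, 4288, 8064, -1440, -17856, -9072, 16980, 12872, -4128, -5368, -1140],
   [1408, 0, -5408, -4688, 11424, 9588, -8972, -8168, 1640, 2628, 548],
   [-256, -896, 1856, 3168, -3776, -4096, 2544, 2656, -352, -704, -144],
   [0, 256, -256, -640, 512, 656, -304, -352, 32, 80, 16]]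

/-- The coefficient of `e^0` in `1000⁶` times the `h`-derivative of the equation of the curve at
`h = (1033 + e) / 1000`, as a polynomial in `w`. -/
def slopeCoeffs0 : List ℤ :=
  [-819101403648000, -27386909816631552, -482147873359688448, -4231588287190197120,
    -19423871753751535104, -36722036059909518352, -25927197869962910032, 1464320329275660384,
    8754370330307001056, 2551111973062510640, 112509222748956528]

/-- The coefficient of `e^1` in `1000⁶` times the `h`-derivative of the equation of the curve at
`h = (1033 + e) / 1000`, as a polynomial in `w`. -/
def slopeCoeffs1 : List ℤ :=
  [-101106593280000, -2476757659774464, -29511675335425536, -143126918609923840,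
    -215737992537468928, -63706004117172064, 80031696533382176, 54934034567309888,
    21405262661328192, 13480198476200480, 2825262614824096]

/-- The coefficient of `e^2` in `1000⁶` times the `h`-derivative of the equation of the curve at
`h = (1033 + e) / 1000`, as a polynomial in `w`. -/
def slopeCoeffs2 : List ℤ :=
  [-4733752320000, -74068149323520, -458410039476480, -407119054531200, 343392160872960,
    601203131358480, 473293492921680, 267246082599840, -52586011465440, -94804253943600,
    -17413606692720]

/-- The coefficient of `e^3` in `1000⁶` times the `h`-derivative of the equation of the curve at
`h = (1033 + e) / 1000`, as a polynomial in `w`. -/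
def slopeCoeffs3 : List ℤ :=
  [-101207040000, -708167377920, -148786222080, 1451853964800, 1849230684160, 787789094080,
    -1475068038720, -1533065695360, -228202522240, 94433534400, 11189618880]

/-- The coefficient of `e^4` in `1000⁶` times the `h`-derivative of the equation of the curve at
`h = (1033 + e) / 1000`, as a polynomial in `w`. -/
def slopeCoeffs4 : List ℤ :=
  [-893440000, 916312320, 1794087680, 3027939200, -2531535360, -5493949680, -82920880, 2029830560,
    876939040, 286587600, 70149520]

/-- The coefficient of `e^5` in `1000⁶` times the `h`-derivative of the equation of the curve at
`h = (1033 + e) / 1000`, as a polynomial in `w`. -/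
def slopeCoeffs5 : List ℤ :=
  [-1536000, 5730816, 29184, -8759040, -442368, 3885216, 2074656, 664128, -723648, -753120, -169824]

/-- The coefficient of `e^6` in `1000⁶` times the `h`-derivative of the equation of the curve at
`h = (1033 + e) / 1000`, as a polynomial in `w`. -/
def slopeCoeffs6 : List ℤ :=
  [0, 1792, -1792, -4480, 3584, 4592, -2128, -2464, 224, 560, 112]

/-- The coefficient of `e^0` in `10000⁷` times the second `w`-derivative of the equation of the
curve at `h = (10331 + e) / 10000`, as a polynomial in `w`. -/
def concavityCoeffs0 : List ℤ :=
  [-106465830251101892880236032, -4044926885695257103083690240, -62629963182800976636331247616,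
    -434777470831619118651451951680, -1468698391557682069297867204320,
    -2510663698178130504393506735424, -2084566763928152125320842373888,
    -665322727370544376087241024640, 1776946595007414349604463840]

/-- The coefficient of `e^1` in `10000⁷` times the second `w`-derivative of the equation of the
curve at `h = (10331 + e) / 10000`, as a polynomial in `w`. -/
def concavityCoeffs1 : List ℤ :=
  [-970207250284465158843904, -25475430292737468869249280, -233345305406816348891953152,
    -734568012950053644712624960, -777575699065491567229907040, 61732288953734895952462272,
    490364578507154645572753664, 183777051237267847509313920, 10151241739701177828048480]

/-- The coefficient of `e^2` in `10000⁷` times the second `w`-derivative of the equation of the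
curve at `h = (10331 + e) / 10000`, as a polynomial in `w`. -/
def concavityCoeffs2 : List ℤ :=
  [-2960336179973112919552, -42962489655931127696640, -129401555183100104165376,
    -63585739879201401436480, 120189466469392056120480, 115473619379955163647936,
    59905268126107127218432, 48460465654429557144960, 12698011032545842086240]

/-- The coefficient of `e^3` in `10000⁷` times the second `w`-derivative of the equation of the
curve at `h = (10331 + e) / 10000`, as a polynomial in `w`. -/
def concavityCoeffs3 : List ℤ :=
  [-3056363784650360320, -8133666335060102400, 13757871127266723840, 40095942565905483200,
    47285096755555456800, 37350079856278445760, -9828824994427738880, -22746217606933046400,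
    -5223073679934861600]

/-- The coefficient of `e^4` in `10000⁷` times the second `w`-derivative of the equation of the
curve at `h = (10331 + e) / 10000`, as a polynomial in `w`. -/
def concavityCoeffs4 : List ℤ :=
  [-74034292062720, 2179596396729600, 5544654077552640, 3927959514107200, -11063257497367200,
    -16088663816111040, -3189925465780480, 1701865694505600, 252397388426400]

/-- The coefficient of `e^5` in `10000⁷` times the second `w`-derivative of the equation of the
curve at `h = (10331 + e) / 10000`, as a polynomial in `w`. -/
def concavityCoeffs5 : List ℤ :=
  [71764080128, 362827080960, -607621441536, -2196802553280, -49130322720, 1705336293696,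
    981766519552, 412144018560, 126116324640]

/-- The coefficient of `e^6` in `10000⁷` times the second `w`-derivative of the equation of the
curve at `h = (10331 + e) / 10000`, as a polynomial in `w`. -/
def concavityCoeffs6 : List ℤ :=
  [93696, -87617280, -8804352, 129599040, 103668960, 46385472, -67527936, -90334080, -25463520]

/-- The coefficient of `e^7` in `10000⁷` times the second `w`-derivative of the equation of the
curve at `h = (10331 + e) / 10000`, as a polynomial in `w`. -/
def concavityCoeffs7 : List ℤ :=
  [-512, -3840, 6144, 13120, -9120, -14784, 1792, 5760, 1440]

/-- `10000⁷` times the equation of the curve at `h = 10331 / 10000`, as a polynomial in `w`. -/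
def sectionCoeffs : List ℤ :=
  [-54223633578446031360000, -2292798658554213742281984, -53232915125550946440118016,
    -674154480949209517180615040, -5219163598566748053027603968, -21738873541580955932572597584,
    -48956613051922735643262240144, -59777707099479297723654922272,
    -37224406498717002237872185248, -9240593435702005223433903120, 19743851055637937217827376]

theorem dvdCheck_curve :
    dvdCheck rootNumCoeffs rootDenCoeffs P5Coeffs (2 ^ 2048) (2 ^ 1700) 548 curveCoeffs = true := by
  decide +kernel

theorem dvdCheck_derivLL_curve :
    dvdCheck rootNumCoeffs rootDenCoeffs P5Coeffs (2 ^ 2048) (2 ^ 1700) 548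
      (derivLL curveCoeffs) = true := by
  decide +kernel

theorem evalL_derivL_P5Coeffs_pos {x : ℝ} (h4 : 4 < x) (h5 : x < 5) :
    0 < evalL (derivL P5Coeffs) x :=
  evalL_pos_of_posCheck (a := 4) (b := 5) (q := 1) (X := 2 ^ 1200) (C := 2 ^ 1000)
    (by decide +kernel) (by norm_num) (by norm_num; linarith) (by norm_num; linarith)

theorem rootNum_lt {x : ℝ} (h4 : 4.1325170786 < x) (h5 : x < 4.1325170787) :
    evalL rootNumCoeffs x < -0.4532248 * evalL rootDenCoeffs x := by
  have := evalL_pos_of_posCheck (a := 41325170786) (b := 41325170787) (q := 10 ^ 10)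
    (X := 2 ^ 8000) (C := 2 ^ 7000) (x := x)
    (p := smulL (-1) (addL (smulL (10 ^ 7) rootNumCoeffs) (smulL 4532248 rootDenCoeffs)))
    (by decide +kernel) (by norm_num) (by norm_num; linarith) (by norm_num; linarith)
  simp only [evalL_smulL, evalL_addL] at this
  push_cast at this
  linarith

theorem lt_rootNum {x : ℝ} (h4 : 4.1325170786 < x) (h5 : x < 4.1325170787) :
    -0.4532250 * evalL rootDenCoeffs x < evalL rootNumCoeffs x := by
  have := evalL_pos_of_posCheck (a := 41325170786) (b := 41325170787) (q := 10 ^ 10)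
    (X := 2 ^ 8000) (C := 2 ^ 7000) (x := x)
    (p := addL (smulL (10 ^ 7) rootNumCoeffs) (smulL 4532250 rootDenCoeffs))
    (by decide +kernel) (by norm_num) (by norm_num; linarith) (by norm_num; linarith)
  simp only [evalL_smulL, evalL_addL] at this
  push_cast at this
  linarith

section Curve

/-- The equation of the curve of pairs `(w, h)` for which `1 - w` is the second and `2 h` the fourth
pivot of a matrix with the suit pattern. With `a = 2 - (2 - h) m` and `m = 2 - w - w²`, it arises by
eliminating the remaining entries. -/
def curve (w h : ℝ) : ℝ :=
  let m := 2 - w - w ^ 2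
  let a := 2 - (2 - h) * m
  let d := a + m
  let r₁ := 2 * h + a - 1
  let r₂ := 2 * h - d - 1
  let T := w * (w + 1) * r₁ - a * (4 * h - 2 - m)
  let Z := -((a - (a - w) * (w ^ 2 + w - a)) * r₁ + a * (1 + a - w) * r₂)
  T * ((d * (2 * h - d) - a) * Z - a * w ^ 4 * (1 + w)) - Z * a * w * (1 + w) * (1 - w - d)

theorem evalLL_curveCoeffs (w h : ℝ) : evalLL curveCoeffs (4 * h) w = 4 ^ 7 * curve w h := by
  simp only [curveCoeffs, evalLL, evalL_cons, evalL_nil, curve]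
  push_cast
  ring

theorem evalLL_curveCoeffsH (w h : ℝ) : evalLL curveCoeffsH w h = curve w h := by
  simp only [curveCoeffsH, evalLL, evalL_cons, evalL_nil, curve]
  push_cast
  ring

theorem evalLL_derivLL_curveCoeffsH (w e : ℝ) :
    evalLL (derivLL curveCoeffsH) w ((1033 + e) / 1000) * 1000 ^ 6 =
      evalL slopeCoeffs0 w + evalL slopeCoeffs1 w * e + evalL slopeCoeffs2 w * e ^ 2 +
        evalL slopeCoeffs3 w * e ^ 3 + evalL slopeCoeffs4 w * e ^ 4 + evalL slopeCoeffs5 w * e ^ 5 +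
        evalL slopeCoeffs6 w * e ^ 6 := by
  simp only [curveCoeffsH, derivLL, addLL, addL, evalLL, evalL_cons, evalL_nil, slopeCoeffs0,
    slopeCoeffs1, slopeCoeffs2, slopeCoeffs3, slopeCoeffs4, slopeCoeffs5, slopeCoeffs6]
  push_cast
  ring

theorem evalLL_derivLL_derivLL_curveCoeffs (w e : ℝ) :
    evalLL (derivLL (derivLL curveCoeffs)) (4 * ((10331 + e) / 10000)) w * 10000 ^ 7 =
      4 ^ 7 * (evalL concavityCoeffs0 w + evalL concavityCoeffs1 w * e +
        evalL concavityCoeffs2 w * e ^ 2 + evalL concavityCoeffs3 w * e ^ 3 +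
        evalL concavityCoeffs4 w * e ^ 4 + evalL concavityCoeffs5 w * e ^ 5 +
        evalL concavityCoeffs6 w * e ^ 6 + evalL concavityCoeffs7 w * e ^ 7) := by
  simp only [curveCoeffs, derivLL, addLL, addL, evalLL, evalL_cons, evalL_nil, concavityCoeffs0,
    concavityCoeffs1, concavityCoeffs2, concavityCoeffs3, concavityCoeffs4, concavityCoeffs5,
    concavityCoeffs6, concavityCoeffs7]
  push_cast
  ring

theorem evalL_sectionCoeffs (w : ℝ) :
    evalL sectionCoeffs w = 10000 ^ 7 * curve w (10331 / 10000) := by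
  simp only [sectionCoeffs, evalL_cons, evalL_nil, curve]
  push_cast
  ring

/-- A polynomial is negative on the interval from `a / q` to `b / q`. -/
theorem evalL_neg_of_posCheck {a b q : ℤ} {p : List ℤ}
    (h : posCheck a b q (2 ^ 2000) (2 ^ 1800) (smulL (-1) p) = true) (hq : 0 < q) {x : ℝ}
    (hax : a < q * x) (hxb : q * x < b) : evalL p x < 0 := by
  have := evalL_pos_of_posCheck h hq hax hxb
  rw [evalL_smulL] at this
  push_cast at this
  linarith

theorem evalLL_derivLL_curveCoeffsH_neg {w h : ℝ} (h1 : -0.9295 < w) (h2 : w < -0.0705)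
    (hh : 1.033 ≤ h) : evalLL (derivLL curveCoeffsH) w h < 0 := by
  obtain ⟨e, rfl⟩ : ∃ e, h = (1033 + e) / 1000 := ⟨1000 * h - 1033, by ring⟩
  have he : 0 ≤ e := by linarith
  have key := evalLL_derivLL_curveCoeffsH w e
  have neg : ∀ {p : List ℤ},
      posCheck (-9295) (-705) 10000 (2 ^ 2000) (2 ^ 1800) (smulL (-1) p) = true →
      evalL p w < 0 := fun hp =>
    evalL_neg_of_posCheck hp (by norm_num) (by norm_num; linarith) (by norm_num; linarith)
  have c0 : evalL slopeCoeffs0 w < 0 := neg (by decide +kernel)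
  have c2 : evalL slopeCoeffs2 w < 0 := neg (by decide +kernel)
  have c4 : evalL slopeCoeffs4 w < 0 := neg (by decide +kernel)
  have c5 : evalL slopeCoeffs5 w < 0 := neg (by decide +kernel)
  have c6 : evalL slopeCoeffs6 w < 0 := neg (by decide +kernel)
  have c01 := neg (p := addL (mulL slopeCoeffs1 slopeCoeffs1)
    (smulL (-3) (mulL slopeCoeffs0 slopeCoeffs2))) (by decide +kernel)
  have c23 : w < -0.1 → evalL slopeCoeffs3 w ^ 2 < evalL slopeCoeffs2 w * evalL slopeCoeffs4 w := by
    intro hw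
    have := evalL_neg_of_posCheck (a := -9295) (b := -1000) (q := 10000) (x := w)
      (p := addL (mulL slopeCoeffs3 slopeCoeffs3) (smulL (-1) (mulL slopeCoeffs2 slopeCoeffs4)))
      (by decide +kernel) (by norm_num) (by norm_num; linarith) (by norm_num; linarith)
    simp only [evalL_addL, evalL_smulL, evalL_mulL] at this
    push_cast at this
    linarith
  have c3 : -0.12 < w → evalL slopeCoeffs3 w < 0 := fun hw =>
    evalL_neg_of_posCheck (a := -1200) (b := -705) (q := 10000) (by decide +kernel) (by norm_num)
      (by norm_num; linarith) (by norm_num; linarith)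
  simp only [evalL_addL, evalL_smulL, evalL_mulL] at c01
  push_cast at c01
  generalize evalL slopeCoeffs0 w = C0 at *
  generalize evalL slopeCoeffs1 w = C1 at *
  generalize evalL slopeCoeffs2 w = C2 at *
  generalize evalL slopeCoeffs3 w = C3 at *
  generalize evalL slopeCoeffs4 w = C4 at *
  generalize evalL slopeCoeffs5 w = C5 at *
  generalize evalL slopeCoeffs6 w = C6 at *
  have q1 : C0 + C1 * e + 3 / 4 * C2 * e ^ 2 < 0 := by
    have : 0 < C0 * (C0 + C1 * e + 3 / 4 * C2 * e ^ 2) := by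
      rcases eq_or_ne e 0 with rfl | he0
      · nlinarith
      · have : 0 < e ^ 2 := by positivity
        nlinarith [sq_nonneg (C0 + C1 * e / 2)]
    exact neg_of_mul_pos_right this c0.le
  have q2 : C2 / 4 + C3 * e + C4 * e ^ 2 ≤ 0 := by
    rcases lt_or_ge w (-0.1) with hw | hw
    · have := c23 hw
      have : 0 ≤ C2 * (C2 / 4 + C3 * e + C4 * e ^ 2) := by
        nlinarith [sq_nonneg (C2 / 2 + C3 * e), sq_nonneg e]
      exact nonpos_of_mul_nonneg_right this c2
    · have := c3 (by linarith)
      nlinarith [sq_nonneg e, mul_nonneg he (neg_nonneg.2 this.le)]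
  have q3 : e ^ 2 * (C2 / 4 + C3 * e + C4 * e ^ 2) ≤ 0 :=
    mul_nonpos_of_nonneg_of_nonpos (by positivity) q2
  have q5 : C5 * e ^ 5 ≤ 0 := mul_nonpos_of_nonpos_of_nonneg c5.le (by positivity)
  have q6 : C6 * e ^ 6 ≤ 0 := mul_nonpos_of_nonpos_of_nonneg c6.le (by positivity)
  linarith

theorem evalLL_derivLL_derivLL_curveCoeffs_neg {w h : ℝ} (h1 : -0.501 < w) (h2 : w < -0.399)
    (hh : 1.0331 ≤ h) (hh' : h ≤ 1.0332) :
    evalLL (derivLL (derivLL curveCoeffs)) (4 * h) w < 0 := by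
  obtain ⟨e, rfl⟩ : ∃ e, h = (10331 + e) / 10000 := ⟨10000 * h - 10331, by ring⟩
  have he : 0 ≤ e := by linarith
  have he1 : e ≤ 1 := by linarith
  have key := evalLL_derivLL_derivLL_curveCoeffs w e
  have neg : ∀ {p : List ℤ},
      posCheck (-501) (-399) 1000 (2 ^ 2000) (2 ^ 1800) (smulL (-1) p) = true →
      evalL p w < 0 := fun hp =>
    evalL_neg_of_posCheck hp (by norm_num) (by norm_num; linarith) (by norm_num; linarith)
  have pos : ∀ {p : List ℤ},
      posCheck (-501) (-399) 1000 (2 ^ 2000) (2 ^ 1800) p = true → 0 < evalL p w := fun hp =>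
    evalL_pos_of_posCheck hp (by norm_num) (by norm_num; linarith) (by norm_num; linarith)
  have c1 : 0 < evalL concavityCoeffs1 w := pos (by decide +kernel)
  have c2 : evalL concavityCoeffs2 w < 0 := neg (by decide +kernel)
  have c3 : 0 < evalL concavityCoeffs3 w := pos (by decide +kernel)
  have c4 : evalL concavityCoeffs4 w < 0 := neg (by decide +kernel)
  have c5 : evalL concavityCoeffs5 w < 0 := neg (by decide +kernel)
  have c6 : 0 < evalL concavityCoeffs6 w := pos (by decide +kernel)
  have c7 : 0 < evalL concavityCoeffs7 w := pos (by decide +kernel)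
  have c := neg (p := addL concavityCoeffs0 (addL concavityCoeffs1 (addL concavityCoeffs3
    (addL concavityCoeffs6 concavityCoeffs7)))) (by decide +kernel)
  simp only [evalL_addL] at c
  have b1 := mul_le_mul_of_nonneg_left he1 c1.le
  have b3 := mul_le_mul_of_nonneg_left (pow_le_one₀ he he1 (n := 3)) c3.le
  have b6 := mul_le_mul_of_nonneg_left (pow_le_one₀ he he1 (n := 6)) c6.le
  have b7 := mul_le_mul_of_nonneg_left (pow_le_one₀ he he1 (n := 7)) c7.le
  have b2 := mul_nonpos_of_nonpos_of_nonneg c2.le (by positivity : 0 ≤ e ^ 2)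
  have b4 := mul_nonpos_of_nonpos_of_nonneg c4.le (by positivity : 0 ≤ e ^ 4)
  have b5 := mul_nonpos_of_nonpos_of_nonneg c5.le (by positivity : 0 ≤ e ^ 5)
  linarith

theorem curve_section_neg {w : ℝ} (h1 : -0.93 < w) (h2 : w < -0.07)
    (hw : w < -0.499 ∨ -0.401 < w) : curve w (10331 / 10000) < 0 := by
  have key := evalL_sectionCoeffs w
  have : evalL sectionCoeffs w < 0 := by
    rcases hw with hw | hw
    · exact evalL_neg_of_posCheck (a := -930) (b := -499) (q := 1000) (by decide +kernel)
        (by norm_num) (by norm_num; linarith) (by norm_num; linarith)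
    · exact evalL_neg_of_posCheck (a := -401) (b := -70) (q := 1000) (by decide +kernel)
        (by norm_num) (by norm_num; linarith) (by norm_num; linarith)
  linarith

theorem curve_strictAntiOn {w : ℝ} (h1 : -0.9295 < w) (h2 : w < -0.0705) :
    StrictAntiOn (curve w) (Set.Ici 1.033) := by
  have hd : ∀ h, HasDerivAt (curve w) (evalLL (derivLL curveCoeffsH) w h) h := by
    intro h
    have := hasDerivAt_evalLL curveCoeffsH w h
    rwa [show evalLL curveCoeffsH w = curve w from funext (evalLL_curveCoeffsH w)] at this
  refine strictAntiOn_of_deriv_neg (convex_Ici _)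
    (fun h _ => (hd h).continuousAt.continuousWithinAt) fun h hh => ?_
  rw [interior_Ici] at hh
  rw [(hd h).deriv]
  exact evalLL_derivLL_curveCoeffsH_neg h1 h2 (le_of_lt hh)

/-- If the section of the curve at `h` has a critical zero, then it is nonpositive nearby. -/
theorem curve_nonpos_of_critical {w₀ h : ℝ} (hw₀ : w₀ ∈ Set.Ioo (-0.501 : ℝ) (-0.399))
    (hh : h ∈ Set.Icc (1.0331 : ℝ) 1.0332) (h0 : evalLL curveCoeffs (4 * h) w₀ = 0)
    (h1 : evalLL (derivLL curveCoeffs) (4 * h) w₀ = 0) {w : ℝ}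
    (hw : w ∈ Set.Ioo (-0.501 : ℝ) (-0.399)) : curve w h ≤ 0 := by
  have anti : StrictAntiOn (evalLL (derivLL curveCoeffs) (4 * h)) (Set.Ioo (-0.501 : ℝ) (-0.399)) := by
    refine strictAntiOn_of_deriv_neg (convex_Ioo _ _)
      (fun u _ => (hasDerivAt_evalLL _ _ u).continuousAt.continuousWithinAt) fun u hu => ?_
    rw [interior_Ioo] at hu
    rw [(hasDerivAt_evalLL _ _ u).deriv]
    exact evalLL_derivLL_derivLL_curveCoeffs_neg hu.1 hu.2 hh.1 hh.2
  have hc : Continuous (evalLL curveCoeffs (4 * h)) :=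
    continuous_iff_continuousAt.2 fun u => (hasDerivAt_evalLL _ _ u).continuousAt
  have key : evalLL curveCoeffs (4 * h) w ≤ 0 := by
    rcases lt_trichotomy w w₀ with hlt | rfl | hlt
    · obtain ⟨c, hc, he⟩ := exists_hasDerivAt_eq_slope _ _ hlt hc.continuousOn
        fun u _ => hasDerivAt_evalLL curveCoeffs (4 * h) u
      have := anti ⟨hw.1.trans hc.1, hc.2.trans hw₀.2⟩ hw₀ hc.2
      rw [h1, he, h0, lt_div_iff₀ (by linarith)] at this
      linarith
    · exact h0.le
    · obtain ⟨c, hc, he⟩ := exists_hasDerivAt_eq_slope _ _ hlt hc.continuousOn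
        fun u _ => hasDerivAt_evalLL curveCoeffs (4 * h) u
      have := anti hw₀ ⟨hw₀.1.trans hc.1, hc.2.trans hw.2⟩ hc.1
      rw [h1, he, h0, div_lt_iff₀ (by linarith)] at this
      linarith
  rw [evalLL_curveCoeffs] at key
  linarith

/-- Beyond a critical zero of a section of the curve, the equation of the curve is negative. -/
theorem curve_neg_of_critical {w₀ h₀ : ℝ} (hw₀ : w₀ ∈ Set.Ioo (-0.501 : ℝ) (-0.399))
    (hh₀ : h₀ ∈ Set.Icc (1.0331 : ℝ) 1.0332) (h0 : evalLL curveCoeffs (4 * h₀) w₀ = 0)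
    (h1 : evalLL (derivLL curveCoeffs) (4 * h₀) w₀ = 0) {w h : ℝ} (hh : h₀ < h)
    (hwh : 2 * h ≤ 2 - w - w ^ 2) : curve w h < 0 := by
  have hh' := hh₀.1
  have hw1 : -0.9295 < w := by nlinarith
  have hw2 : w < -0.0705 := by nlinarith
  have anti := curve_strictAntiOn hw1 hw2
  by_cases hw : w < -0.499 ∨ -0.401 < w
  · refine (anti (a := 10331 / 10000) ?_ ?_ ?_).trans
      (curve_section_neg (by linarith) (by linarith) hw)
    · norm_num
    · exact (by linarith : (1.033 : ℝ) ≤ h)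
    · linarith
  · push Not at hw
    refine (anti ?_ ?_ hh).trans_le (curve_nonpos_of_critical hw₀ hh₀ h0 h1 (w := w) ⟨?_, ?_⟩)
    · exact (by linarith : (1.033 : ℝ) ≤ h₀)
    · exact (by linarith : (1.033 : ℝ) ≤ h)
    · linarith
    · linarith

end Curve

section Root

open Polynomial

theorem aeval_foldr (p : List ℤ) (x : ℝ) :
    aeval x (p.foldr (fun c p => C c + X * p) (0 : ℤ[X])) = evalL p x := by
  induction p with
  | nil => simp
  | cons c p ih =>
    rw [List.foldr_cons, map_add, map_mul, aeval_X, aeval_C, ih, evalL_cons]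
    rfl

theorem aeval_P5 (x : ℝ) : aeval x P5 = evalL P5Coeffs x := aeval_foldr _ _

theorem coeff_foldr (p : List ℤ) (n : ℕ) :
    (p.foldr (fun c p => C c + X * p) (0 : ℤ[X])).coeff n = p.getD n 0 := by
  induction p generalizing n with
  | nil => simp
  | cons c p ih =>
    rw [List.foldr_cons, coeff_add]
    cases n with
    | zero => rw [coeff_C_zero, coeff_X_mul_zero, add_zero, List.getD_cons_zero]
    | succ n => rw [coeff_C_succ, coeff_X_mul, ih, zero_add, List.getD_cons_succ]

theorem natDegree_P5 : P5.natDegree = 61 := by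
  refine natDegree_eq_of_le_of_coeff_ne_zero ?_ ?_
  · refine natDegree_le_iff_coeff_eq_zero.2 fun n hn => ?_
    rw [P5, coeff_foldr]
    exact List.getD_eq_default _ _ (Nat.succ_le_of_lt hn)
  · rw [P5, coeff_foldr]
    decide

theorem strictMonoOn_P5 : StrictMonoOn (evalL (R := ℝ) P5Coeffs) (Set.Ioo 4 5) := by
  refine strictMonoOn_of_deriv_pos (convex_Ioo _ _)
    (fun x _ => (hasDerivAt_evalL _ x).continuousAt.continuousWithinAt) fun x hx => ?_
  rw [interior_Ioo] at hx
  rw [(hasDerivAt_evalL _ x).deriv]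
  exact evalL_derivL_P5Coeffs_pos hx.1 hx.2

theorem exists_root_P5 :
    ∃ g : ℝ, 4.1325170786 < g ∧ g < 4.1325170787 ∧ evalL P5Coeffs g = 0 := by
  have hc : ContinuousOn (evalL (R := ℝ) P5Coeffs) (Set.Icc 4.1325170786 4.1325170787) :=
    fun x _ => (hasDerivAt_evalL _ x).continuousAt.continuousWithinAt
  have hl : evalL P5Coeffs (4.1325170786 : ℝ) < 0 := by
    norm_num [P5Coeffs]
  have hu : 0 < evalL P5Coeffs (4.1325170787 : ℝ) := by
    norm_num [P5Coeffs]
  obtain ⟨g, hg, h0⟩ := intermediate_value_Ioo (by norm_num) hc ⟨hl, hu⟩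
  exact ⟨g, hg.1, hg.2, h0⟩

/-- At a root `g` of `P5`, the section of the curve at `g / 4` has a critical zero. -/
theorem exists_critical {g : ℝ} (h1 : 4.1325170786 < g) (h2 : g < 4.1325170787)
    (hg : evalL P5Coeffs g = 0) :
    ∃ w : ℝ, -0.4532250 < w ∧ w < -0.4532248 ∧ evalLL curveCoeffs g w = 0 ∧
      evalLL (derivLL curveCoeffs) g w = 0 := by
  have hD : 0 < evalL rootDenCoeffs g := by
    rw [rootDenCoeffs, evalL_smulL]
    have := evalL_derivL_P5Coeffs_pos (x := g) (by linarith) (by linarith)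
    push_cast
    positivity
  have hN1 := rootNum_lt h1 h2
  have hN2 := lt_rootNum h1 h2
  have hw : evalL rootDenCoeffs g * (evalL rootNumCoeffs g / evalL rootDenCoeffs g) =
      evalL rootNumCoeffs g := by field_simp
  exact ⟨evalL rootNumCoeffs g / evalL rootDenCoeffs g, (lt_div_iff₀ hD).2 hN2,
    (div_lt_iff₀ hD).2 hN1, evalLL_eq_zero_of_dvdCheck dvdCheck_curve hg hD.ne' hw,
    evalLL_eq_zero_of_dvdCheck dvdCheck_derivLL_curve hg hD.ne' hw⟩

end Root

section Elimination

/-- The relations between the entries of a matrix with the suit pattern imply that `(w, K / 2)` lies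
on the curve. -/
theorem curve_eq_zero_of_relations {w x c₂ c₄ x₃ t α K a b d : ℝ} (ha : a = w * (1 + x))
    (hd : d = 2 - w ^ 2 + x * w) (hc₄ : c₄ * (1 + x) = 2 - d) (hx₃ : x₃ * c₂ = w) (hc₂ : c₂ ≠ 0)
    (h₁₁ : 1 - w * x₃ + t * (1 + x * w) = K + a) (h₁₂ : 1 - x₃ * c₄ - t * (1 - x * c₄) = K - d)
    (h₀₀ : d = 1 - w - t * α) (hab : a * b = d * (K - d)) (h₂₂ : 2 + (w - x) * c₄ = K - b)
    (hb : b = 1 + w * c₂ + α) : curve w (K / 2) = 0 := by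
  obtain ⟨z, hz⟩ : ∃ z, z * c₂ = 1 := ⟨c₂⁻¹, inv_mul_cancel₀ hc₂⟩
  have hx₃ : x₃ = w * z := by linear_combination z * hx₃ - x₃ * hz
  subst hx₃
  have hK : 2 - (2 - K / 2) * (2 - w - w ^ 2) = a := by
    subst ha hd
    linear_combination (1 / 2) * (w * (1 + x) * h₂₂ - hab - w * (w - x) * hc₄)
  have hT : t * (1 + w) = (w - x) * (K + a - 1) - (1 + x) * (K - d - 1) := by
    subst ha hd
    linear_combination (w - x) * h₁₁ - (1 + x) * h₁₂ - (w * z - t * x) * hc₄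
  have hZ : z * (w ^ 2 * (1 + w)) =
      -((1 + x - x * w * (w - x)) * (K + a - 1) + (1 + x) * (1 + x * w) * (K - d - 1)) := by
    subst ha hd
    linear_combination -(1 + x - x * w * (w - x)) * h₁₁ - (1 + x) * (1 + x * w) * h₁₂ +
      (t * x - z * w) * (1 + x * w) * hc₄
  have hrel : t * ((b - 1) * z - w) = z * (1 - w - d) := by
    linear_combination t * z * hb + t * w * hz + z * h₀₀
  have hm : d = a + (2 - w - w ^ 2) := by linear_combination hd - ha
  have hT' : w * (w + 1) * (2 * (K / 2) + a - 1) - a * (4 * (K / 2) - 2 - (2 - w - w ^ 2)) =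
      t * (w * (1 + w)) := by
    subst ha hd
    linear_combination -w * hT
  have hZ' : -((a - (a - w) * (w ^ 2 + w - a)) * (2 * (K / 2) + a - 1) +
      a * (1 + a - w) * (2 * (K / 2) - d - 1)) = z * (w ^ 3 * (1 + w)) := by
    subst ha hd
    linear_combination -w * hZ
  have key : t * (w * (1 + w)) * ((d * (2 * (K / 2) - d) - a) * (z * (w ^ 3 * (1 + w))) -
      a * w ^ 4 * (1 + w)) - z * (w ^ 3 * (1 + w)) * a * w * (1 + w) * (1 - w - d) = 0 := by
    linear_combination a * w ^ 4 * (1 + w) ^ 2 * hrel - t * w ^ 4 * (1 + w) ^ 2 * z * hab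
  simp only [curve]
  rw [hK, ← hm, hT', hZ']
  exact key

/-- Conversely, for a point on the curve, the values of `t` and `z = 1 / c₂` that are determined by the
linear relations satisfy the remaining one. -/
theorem relation_of_curve_eq_zero {w t z K a b d : ℝ} (hw : w ≠ 0) (hw' : 1 + w ≠ 0) (ha0 : a ≠ 0)
    (hd : d = a + (2 - w - w ^ 2))
    (hK : 2 - (2 - K / 2) * (2 - w - w ^ 2) = a)
    (hT : w * (w + 1) * (K + a - 1) - a * (2 * K - 2 - (2 - w - w ^ 2)) = t * (w * (1 + w)))
    (hZ : -((a - (a - w) * (w ^ 2 + w - a)) * (K + a - 1) + a * (1 + a - w) * (K - d - 1)) =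
      z * (w ^ 3 * (1 + w))) (hab : a * b = d * (K - d)) (hc : curve w (K / 2) = 0) :
    t * ((b - 1) * z - w) = z * (1 - w - d) := by
  simp only [curve] at hc
  rw [hK, ← hd, show 2 * (K / 2) = K by ring, show 4 * (K / 2) = 2 * K by ring, hT, hZ] at hc
  have : a * w ^ 4 * (1 + w) ^ 2 ≠ 0 := by positivity
  refine mul_left_cancel₀ this ?_
  linear_combination hc + t * w ^ 4 * (1 + w) ^ 2 * z * hab

theorem CompletelyPivoted.abs_le {n : ℕ} {A : Matrix (Fin (n + 1)) (Fin (n + 1)) ℝ}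
    (hA : CompletelyPivoted A) (i j : Fin (n + 1)) : |A i j| ≤ |A 0 0| := hA.1 i j

theorem CompletelyPivoted.elimStep {n : ℕ} {A : Matrix (Fin (n + 1)) (Fin (n + 1)) ℝ}
    (hA : CompletelyPivoted A) : CompletelyPivoted (elimStep A) := hA.2

theorem CompletelyPivoted.eq_zero {n : ℕ} {A : Matrix (Fin (n + 1)) (Fin (n + 1)) ℝ}
    (hA : CompletelyPivoted A) (h : A 0 0 = 0) (i j : Fin (n + 1)) : A i j = 0 := by
  have := hA.abs_le i j
  rwa [h, abs_zero, abs_nonpos_iff] at this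

/-- The pivots of a completely pivoted matrix at most double in each step. -/
theorem CompletelyPivoted.abs_elimStep_le {n : ℕ}
    {A : Matrix (Fin (n + 2)) (Fin (n + 2)) ℝ} (hA : CompletelyPivoted A) :
    |_root_.elimStep A 0 0| ≤ 2 * |A 0 0| := by
  change |A 1 1 - A 1 0 * A 0 1 / A 0 0| ≤ _
  have h1 : |A 1 0 * A 0 1 / A 0 0| ≤ |A 0 0| := by
    rcases eq_or_ne (A 0 0) 0 with h | h
    · simp [h]
    · rw [abs_div, abs_mul, div_le_iff₀ (abs_pos.2 h)]
      exact mul_le_mul (hA.abs_le _ _) (hA.abs_le _ _) (abs_nonneg _) (abs_nonneg _)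
  have h2 := hA.abs_le 1 1
  have h3 := abs_sub (A 1 1) (A 1 0 * A 0 1 / A 0 0)
  linarith

/-- The fourth pivot of a completely pivoted matrix with the suit pattern is at most `2 h₀`, if the
curve avoids the region of larger `h`. -/
theorem abs_club_le {A : Matrix (Fin 5) (Fin 5) ℝ} (hA : CompletelyPivoted A) (hP : SuitPattern A)
    {h₀ : ℝ} (h1 : 1 ≤ h₀)
    (hcurve : ∀ w h, h₀ < h → 2 * h ≤ 2 - w - w ^ 2 → curve w h < 0) :
    |elimStep (elimStep (elimStep A)) 0 0| ≤ 2 * h₀ := by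
  have hA2 := hA.elimStep
  have hA3 := hA2.elimStep
  have hA4 := hA3.elimStep
  have e2 : ∀ i j, elimStep A i j = A i.succ j.succ - A i.succ 0 * A 0 j.succ / A 0 0 :=
    fun _ _ => rfl
  have e3 : ∀ i j, elimStep (elimStep A) i j = elimStep A i.succ j.succ -
      elimStep A i.succ 0 * elimStep A 0 j.succ / elimStep A 0 0 := fun _ _ => rfl
  have e4 : ∀ i j, elimStep (elimStep (elimStep A)) i j = elimStep (elimStep A) i.succ j.succ -
      elimStep (elimStep A) i.succ 0 * elimStep (elimStep A) 0 j.succ /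
        elimStep (elimStep A) 0 0 := fun _ _ => rfl
  obtain ⟨⟨p00, p01⟩, ⟨p13, p14⟩, ⟨p20, p23, p24⟩, ⟨p32, p33, p34⟩, ⟨p41, p42, p43, p44⟩, s1, s2,
    s3,
    s4, d1, d2, d3, k1, k2, k3⟩ := hP
  generalize hM2 : elimStep A = M2 at *
  generalize hM3 : elimStep M2 = M3 at *
  generalize hM4 : elimStep M3 = M4 at *
  by_contra! hcon
  have hM3ne : M3 0 0 ≠ 0 := by
    intro h
    have := e4 0 0
    rw [hA3.eq_zero h, hA3.eq_zero h, zero_mul, zero_div, sub_zero] at this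
    rw [this, abs_zero] at hcon
    linarith
  have hM2ne : M2 0 0 ≠ 0 := by
    intro h
    refine hM3ne ?_
    rw [e3, hA2.eq_zero h, hA2.eq_zero h, zero_mul, zero_div, sub_zero]
  have bx : |A 1 0| ≤ 1 := by simpa [p00] using hA.abs_le 1 0
  have bw : |A 0 3| ≤ 1 := by simpa [p00] using hA.abs_le 0 3
  have f00 : M2 0 0 = A 1 1 - A 1 0 * A 0 1 / A 0 0 := e2 0 0
  have f02 : M2 0 2 = A 1 3 - A 1 0 * A 0 3 / A 0 0 := e2 0 2
  have f03 : M2 0 3 = A 1 4 - A 1 0 * A 0 4 / A 0 0 := e2 0 3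
  have f12 : M2 1 2 = A 2 3 - A 2 0 * A 0 3 / A 0 0 := e2 1 2
  have f13 : M2 1 3 = A 2 4 - A 2 0 * A 0 4 / A 0 0 := e2 1 3
  have f21 : M2 2 1 = A 3 2 - A 3 0 * A 0 2 / A 0 0 := e2 2 1
  have f22 : M2 2 2 = A 3 3 - A 3 0 * A 0 3 / A 0 0 := e2 2 2
  have f23 : M2 2 3 = A 3 4 - A 3 0 * A 0 4 / A 0 0 := e2 2 3
  have f30 : M2 3 0 = A 4 1 - A 4 0 * A 0 1 / A 0 0 := e2 3 0
  have f31 : M2 3 1 = A 4 2 - A 4 0 * A 0 2 / A 0 0 := e2 3 1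
  have f32 : M2 3 2 = A 4 3 - A 4 0 * A 0 3 / A 0 0 := e2 3 2
  have f33 : M2 3 3 = A 4 4 - A 4 0 * A 0 4 / A 0 0 := e2 3 3
  simp only [p00, p01, p13, p14, p20, p23, p24, p32, p33, p34, p41, p42, p43, p44, div_one, mul_one]
    at f00 f02 f03 f12 f13 f21 f22 f23 f30 f31 f32 f33
  have g00 : M3 0 0 = M2 1 1 - M2 1 0 * M2 0 1 / M2 0 0 := e3 0 0
  have g01 : M3 0 1 = M2 1 2 - M2 1 0 * M2 0 2 / M2 0 0 := e3 0 1
  have g02 : M3 0 2 = M2 1 3 - M2 1 0 * M2 0 3 / M2 0 0 := e3 0 2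
  have g10 : M3 1 0 = M2 2 1 - M2 2 0 * M2 0 1 / M2 0 0 := e3 1 0
  have g11 : M3 1 1 = M2 2 2 - M2 2 0 * M2 0 2 / M2 0 0 := e3 1 1
  have g12 : M3 1 2 = M2 2 3 - M2 2 0 * M2 0 3 / M2 0 0 := e3 1 2
  have g20 : M3 2 0 = M2 3 1 - M2 3 0 * M2 0 1 / M2 0 0 := e3 2 0
  have g21 : M3 2 1 = M2 3 2 - M2 3 0 * M2 0 2 / M2 0 0 := e3 2 1
  have g22 : M3 2 2 = M2 3 3 - M2 3 0 * M2 0 3 / M2 0 0 := e3 2 2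
  have h00 : M4 0 0 = M3 1 1 - M3 1 0 * M3 0 1 / M3 0 0 := e4 0 0
  have h01 : M4 0 1 = M3 1 2 - M3 1 0 * M3 0 2 / M3 0 0 := e4 0 1
  have h10 : M4 1 0 = M3 2 1 - M3 2 0 * M3 0 1 / M3 0 0 := e4 1 0
  have h11 : M4 1 1 = M3 2 2 - M3 2 0 * M3 0 2 / M3 0 0 := e4 1 1
  have b11 := hA3.abs_le 1 1
  have b12 := hA3.abs_le 1 2
  obtain ⟨t, ht⟩ : ∃ t, t = M2 2 0 / M2 0 0 := ⟨_, rfl⟩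
  rw [s4] at g20 g21 g22
  rw [s1] at g00 g01 g02
  rw [mul_div_right_comm] at g00 g01 g02 g10 g11 g12 g20 g21 g22
  rw [mul_div_right_comm] at h00 h01 h10 h11
  rw [← ht] at g10 g11 g12
  rw [neg_div, div_self hM2ne] at g20 g21 g22
  rw [div_self hM2ne] at g00 g01 g02
  rw [d2, div_self hM3ne] at h00 h01
  rw [s3] at f21 g10
  rw [s2] at f12 g01
  rw [s4] at f30
  rw [d2] at g10
  rw [d1] at g02 h01 h11
  rw [d3] at g21 h10
  rw [k1] at h01
  rw [k2] at h10
  rw [k3] at h11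
  clear ht s1 s2 s3 s4 d1 d2 d3 k1 k2 k3 e2 e3 e4 hA hA2 hA3 hA4 hM2 hM3 hM4 p00 p01 p13 p14 p20 p23 p24 p32 p33
    p34 p41 p42 p43 p44
  generalize A 0 2 = c₂ at *
  generalize A 0 3 = w at *
  generalize A 0 4 = c₄ at *
  generalize A 1 0 = x at *
  generalize A 3 0 = x₃ at *
  generalize A 4 0 = x₄ at *
  generalize M2 0 0 = s at *
  generalize M2 0 1 = α at *
  generalize M3 0 0 = d at *
  generalize M3 0 1 = a at *
  generalize M3 2 0 = b at *
  generalize M4 0 0 = K at *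
  generalize M2 0 2 = m202 at *
  generalize M2 0 3 = m203 at *
  generalize M2 1 1 = m211 at *
  generalize M2 1 3 = m213 at *
  generalize M2 2 2 = m222 at *
  generalize M2 2 3 = m223 at *
  generalize M2 3 1 = m231 at *
  generalize M2 3 2 = m232 at *
  generalize M2 3 3 = m233 at *
  generalize M3 1 1 = m311 at *
  generalize M3 1 2 = m312 at *
  generalize M3 2 2 = m322 at *
  have hd : d = 2 - w ^ 2 + x * w := by
    linear_combination -g21 - f32 - f02 - w * f12 + w * f30
  have hab : a * b = d * (K - d) := by
    field_simp at h10
    linear_combination h10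
  have h22 : K = m322 + b := by
    field_simp at h11
    linear_combination h11
  have ha : a = w * (1 + x) := by linear_combination g01 + f12 - f02
  have hdpos : 0 ≤ d := by
    rw [hd]
    nlinarith [abs_le.1 bx, abs_le.1 bw]
  rw [abs_of_nonneg hdpos, abs_le] at b11 b12
  have hKpos : 0 ≤ K := by linarith
  rw [abs_of_nonneg hKpos] at hcon
  have hreg : K ≤ 2 - w - w ^ 2 := by linarith
  have hw0 : w ≠ 0 := by
    intro h
    rw [h] at hreg
    linarith
  have hx₃ : x₃ * c₂ = w := by linear_combination f21 + f12
  have hzero := curve_eq_zero_of_relations (w := w) (x := x) (c₂ := c₂) (c₄ := c₄)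
    (x₃ := x₃) (t := t) (α := α) (K := K) (a := a) (b := b) (d := d)
    ha hd ?_ hx₃ ?_ ?_ ?_ ?_ hab ?_ ?_
  · have := hcurve (w) (K / 2) (by linarith) (by linarith)
    linarith
  · linear_combination -g02 - f13 + f03
  · rintro h
    rw [h, mul_zero] at hx₃
    exact hw0 hx₃.symm
  · linear_combination -h00 - g11 - f22 + t * f02
  · linear_combination -h01 - g12 - f23 + t * f03
  · linear_combination g10 - f12
  · linear_combination -h22 - g22 - f33 - f03 - c₄ * f12 + c₄ * f30
  · linear_combination g20 + f31 + c₂ * f12 - c₂ * f30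

end Elimination

section Construction

theorem near_mul {x x₀ e y y₀ f p c : ℝ} (hx : |x - x₀| ≤ e) (hy : |y - y₀| ≤ f)
    (h : |x₀| * f + |y₀| * e + e * f + |x₀ * y₀ - p| ≤ c) : |x * y - p| ≤ c := by
  refine le_trans ?_ h
  have key : x * y - p = x₀ * (y - y₀) + y₀ * (x - x₀) + (x - x₀) * (y - y₀) + (x₀ * y₀ - p) := by
    ring
  have he := (abs_nonneg _).trans hx
  rw [key]
  refine (abs_add_le _ _).trans (add_le_add ((abs_add_three _ _ _).trans ?_) le_rfl)
  rw [abs_mul, abs_mul, abs_mul]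
  gcongr

theorem exists_near_div {x x₀ e y y₀ f q₀ c : ℝ} (hx : |x - x₀| ≤ e) (hy : |y - y₀| ≤ f)
    (hf : f < |y₀|) (h : |q₀ * y₀ - x₀| + e + |q₀| * f ≤ c * (|y₀| - f)) :
    ∃ q, q * y = x ∧ |q - q₀| ≤ c := by
  have hy' : |y₀| - f ≤ |y| := by
    have := abs_sub_abs_le_abs_sub y₀ y
    rw [abs_sub_comm y₀ y] at this
    linarith
  have hy0 : 0 < |y| := by linarith
  refine ⟨x / y, div_mul_cancel₀ _ (abs_pos.1 hy0), ?_⟩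
  have hc : 0 ≤ c := by
    have h1 : 0 ≤ e := (abs_nonneg _).trans hx
    have h2 : 0 ≤ f := (abs_nonneg _).trans hy
    exact nonneg_of_mul_nonneg_left (le_trans (by positivity) h) (by linarith)
  have key : x / y - q₀ = ((x - x₀) - q₀ * (y - y₀) - (q₀ * y₀ - x₀)) / y := by
    field_simp [abs_pos.1 hy0]
    ring
  rw [key, abs_div, div_le_iff₀ hy0]
  calc |x - x₀ - q₀ * (y - y₀) - (q₀ * y₀ - x₀)|
      ≤ |x - x₀| + |q₀ * (y - y₀)| + |q₀ * y₀ - x₀| :=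
        (abs_sub _ _).trans (add_le_add (abs_sub _ _) le_rfl)
    _ ≤ e + |q₀| * f + |q₀ * y₀ - x₀| := by
        rw [abs_mul]
        gcongr
    _ ≤ c * (|y₀| - f) := by linarith
    _ ≤ c * |y| := by gcongr

/-- The relations between the parameters of a matrix with the suit pattern, and approximate values
of the parameters at the optimum. -/
structure SuitParameters (w h x c₂ c₄ x₃ t α a b d : ℝ) : Prop where
  near_w : |w - (-0.4532249)| ≤ 0.0000001
  ha : a = w * (1 + x)
  hd : d = 2 - w ^ 2 + x * w
  hc₄ : c₄ * (1 + x) = 2 - d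
  hx₃ : x₃ * c₂ = w
  h₁₁ : 1 - w * x₃ + t * (1 + x * w) = 2 * h + a
  h₁₂ : 1 - x₃ * c₄ - t * (1 - x * c₄) = 2 * h - d
  h₀₀ : d = 1 - w - t * α
  hab : a * b = d * (2 * h - d)
  h₂₂ : 2 + (w - x) * c₄ = 2 * h - b
  hb : b = 1 + w * c₂ + α
  near_x : |x - (-0.617532673)| ≤ 0.0000005
  near_c2 : |c₂ - (0.581690911)| ≤ 0.000005321
  near_c4 : |c₄ - (-0.194705189)| ≤ 0.00000125
  near_x3 : |x₃ - (-0.779150734)| ≤ 0.000007299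
  near_ga : |t * (1 - w) - (1.414806416)| ≤ 0.000002797
  near_al : |α - (-0.638113074)| ≤ 0.000007158
  near_a : |a - (-0.173343716)| ≤ 0.000000188
  near_b : |b - (0.098250121)| ≤ 0.000004688
  near_d : |d - (2.074468374)| ≤ 0.000000379
  near_xc2 : |x * c₂ - (-0.359213143)| ≤ 0.000003577
  near_xw : |x * w - (0.279881184)| ≤ 0.000000289
  near_xc4 : |x * c₄ - (0.120236816)| ≤ 0.00000087
  near_x3w : |x₃ * w - (0.353130514)| ≤ 0.000003387
  near_x3c4 : |x₃ * c₄ - (0.151704691)| ≤ 0.000002396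
  near_wc2 : |w * c₂ - (-0.263636805)| ≤ 0.00000247
  near_u : |w * w - (0.20541281)| ≤ 0.000000091
  near_wc4 : |w * c₄ - (0.08824524)| ≤ 0.000000587
  near_K : |(2 * h) - (2.06625854)| ≤ 0.000000002

theorem exists_suitParameters {w h : ℝ} (hw : |w - (-0.4532249)| ≤ 0.0000001)
    (hh : |h - 1.03312927| ≤ 0.000000001) (hcurve : curve w h = 0) :
    ∃ x c₂ c₄ x₃ t α a b d : ℝ, SuitParameters w h x c₂ c₄ x₃ t α a b d := by
  have hK : |(2 * h) - (2.06625854)| ≤ 0.000000002 :=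
    abs_le.2 ⟨by linarith only [(abs_le.1 hh).1, (abs_le.1 hh).2],
      by linarith only [(abs_le.1 hh).1, (abs_le.1 hh).2]⟩
  have hu : |w * w - (0.20541281)| ≤ 0.000000091 :=
    near_mul hw hw (by norm_num [abs_of_nonneg, abs_of_nonpos])
  obtain ⟨m, em⟩ : ∃ m, m = 2 - w - w * w := ⟨_, rfl⟩
  have hm : |m - (2.24781209)| ≤ 0.000000191 :=
    abs_le.2 ⟨by linarith only [em, (abs_le.1 hw).1, (abs_le.1 hw).2, (abs_le.1 hu).1,
      (abs_le.1 hu).2],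
      by linarith only [em, (abs_le.1 hw).1, (abs_le.1 hw).2, (abs_le.1 hu).1, (abs_le.1 hu).2]⟩
  have hh2 : |(2 - h) - (0.96687073)| ≤ 0.000000001 :=
    abs_le.2 ⟨by linarith only [(abs_le.1 hh).1, (abs_le.1 hh).2],
      by linarith only [(abs_le.1 hh).1, (abs_le.1 hh).2]⟩
  have hq : |(2 - h) * m - (2.173343716)| ≤ 0.000000188 :=
    near_mul hh2 hm (by norm_num [abs_of_nonneg, abs_of_nonpos])
  obtain ⟨a, ea⟩ : ∃ a, a = 2 - (2 - h) * m := ⟨_, rfl⟩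
  have ha : |a - (-0.173343716)| ≤ 0.000000188 :=
    abs_le.2 ⟨by linarith only [ea, (abs_le.1 hq).1, (abs_le.1 hq).2],
      by linarith only [ea, (abs_le.1 hq).1, (abs_le.1 hq).2]⟩
  obtain ⟨d, ed⟩ : ∃ d, d = a + m := ⟨_, rfl⟩
  have hd : |d - (2.074468374)| ≤ 0.000000379 :=
    abs_le.2 ⟨by linarith only [ed, (abs_le.1 ha).1, (abs_le.1 ha).2, (abs_le.1 hm).1,
      (abs_le.1 hm).2],
      by linarith only [ed, (abs_le.1 ha).1, (abs_le.1 ha).2, (abs_le.1 hm).1, (abs_le.1 hm).2]⟩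
  obtain ⟨x₁, ex, hx1⟩ : ∃ q, q * w = a ∧ |q - (0.382467327)| ≤ 0.0000005 :=
    exists_near_div ha hw (by norm_num [abs_of_nonneg, abs_of_nonpos])
      (by norm_num [abs_of_nonneg, abs_of_nonpos])
  obtain ⟨x, rfl⟩ : ∃ x, x₁ = 1 + x := ⟨x₁ - 1, by ring⟩
  have hx : |x - (-0.617532673)| ≤ 0.0000005 :=
    abs_le.2 ⟨by linarith only [(abs_le.1 hx1).1, (abs_le.1 hx1).2],
      by linarith only [(abs_le.1 hx1).1, (abs_le.1 hx1).2]⟩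
  have hr1 : |(2 * h + a - 1) - (0.892914824)| ≤ 0.00000019 :=
    abs_le.2 ⟨by linarith only [(abs_le.1 hK).1, (abs_le.1 hK).2, (abs_le.1 ha).1, (abs_le.1 ha).2],
      by linarith only [(abs_le.1 hK).1, (abs_le.1 hK).2, (abs_le.1 ha).1, (abs_le.1 ha).2]⟩
  have hr2 : |(2 * h - d - 1) - (-1.008209834)| ≤ 0.000000381 :=
    abs_le.2 ⟨by linarith only [(abs_le.1 hK).1, (abs_le.1 hK).2, (abs_le.1 hd).1, (abs_le.1 hd).2],
      by linarith only [(abs_le.1 hK).1, (abs_le.1 hK).2, (abs_le.1 hd).1, (abs_le.1 hd).2]⟩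
  have hv : |(w * (1 + w)) - (-0.24781209)| ≤ 0.000000191 :=
    abs_le.2 ⟨by linarith only [(abs_le.1 hw).1, (abs_le.1 hw).2, (abs_le.1 hu).1, (abs_le.1 hu).2],
      by linarith only [(abs_le.1 hw).1, (abs_le.1 hw).2, (abs_le.1 hu).1, (abs_le.1 hu).2]⟩
  have hk1 : |(w * (1 + w)) * (2 * h + a - 1) - (-0.221275089)| ≤ 0.000000218 :=
    near_mul hv hr1 (by norm_num [abs_of_nonneg, abs_of_nonpos])
  have hs1 : |(2 * (2 * h) - 2 - m) - (-0.11529501)| ≤ 0.000000195 :=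
    abs_le.2 ⟨by linarith only [(abs_le.1 hK).1, (abs_le.1 hK).2, (abs_le.1 hm).1, (abs_le.1 hm).2],
      by linarith only [(abs_le.1 hK).1, (abs_le.1 hK).2, (abs_le.1 hm).1, (abs_le.1 hm).2]⟩
  have hk2 : |a * (2 * (2 * h) - 2 - m) - (0.019985665)| ≤ 0.000000056 :=
    near_mul ha hs1 (by norm_num [abs_of_nonneg, abs_of_nonpos])
  obtain ⟨T, eT⟩ : ∃ T, T = w * (1 + w) * (2 * h + a - 1) - a * (2 * (2 * h) - 2 - m) := ⟨_, rfl⟩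
  have hT : |T - (-0.241260754)| ≤ 0.000000274 :=
    abs_le.2 ⟨by linarith only [eT, (abs_le.1 hk1).1, (abs_le.1 hk1).2, (abs_le.1 hk2).1,
      (abs_le.1 hk2).2],
      by linarith only [eT, (abs_le.1 hk1).1, (abs_le.1 hk1).2, (abs_le.1 hk2).1, (abs_le.1 hk2).2]⟩
  obtain ⟨t, et, ht⟩ : ∃ q, q * ((w * (1 + w))) = T ∧ |q - (0.973563291)| ≤ 0.000001857 :=
    exists_near_div hT hv (by norm_num [abs_of_nonneg, abs_of_nonpos])
      (by norm_num [abs_of_nonneg, abs_of_nonpos])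
  have haw : |(a - w) - (0.279881184)| ≤ 0.000000288 :=
    abs_le.2 ⟨by linarith only [(abs_le.1 ha).1, (abs_le.1 ha).2, (abs_le.1 hw).1, (abs_le.1 hw).2],
      by linarith only [(abs_le.1 ha).1, (abs_le.1 ha).2, (abs_le.1 hw).1, (abs_le.1 hw).2]⟩
  have hs2 : |(w * (1 + w) - a) - (-0.074468374)| ≤ 0.000000379 :=
    abs_le.2 ⟨by linarith only [(abs_le.1 hv).1, (abs_le.1 hv).2, (abs_le.1 ha).1, (abs_le.1 ha).2],
      by linarith only [(abs_le.1 hv).1, (abs_le.1 hv).2, (abs_le.1 ha).1, (abs_le.1 ha).2]⟩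
  have hk3 : |(a - w) * (w * (1 + w) - a) - (-0.020842297)| ≤ 0.000000128 :=
    near_mul haw hs2 (by norm_num [abs_of_nonneg, abs_of_nonpos])
  have hs3 : |(a - (a - w) * (w * (1 + w) - a)) - (-0.152501419)| ≤ 0.000000316 :=
    abs_le.2 ⟨by linarith only [(abs_le.1 ha).1, (abs_le.1 ha).2, (abs_le.1 hk3).1,
      (abs_le.1 hk3).2],
      by linarith only [(abs_le.1 ha).1, (abs_le.1 ha).2, (abs_le.1 hk3).1, (abs_le.1 hk3).2]⟩
  have hk4 : |(a - (a - w) * (w * (1 + w) - a)) * (2 * h + a - 1) - (-0.136170778)| ≤ 0.000000312 :=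
    near_mul hs3 hr1 (by norm_num [abs_of_nonneg, abs_of_nonpos])
  have hs4 : |(1 + a - w) - (1.279881184)| ≤ 0.000000288 :=
    abs_le.2 ⟨by linarith only [(abs_le.1 haw).1, (abs_le.1 haw).2],
      by linarith only [(abs_le.1 haw).1, (abs_le.1 haw).2]⟩
  have hk5 : |a * (1 + a - w) - (-0.22185936)| ≤ 0.000000292 :=
    near_mul ha hs4 (by norm_num [abs_of_nonneg, abs_of_nonpos])
  have hk6 : |(a * (1 + a - w)) * (2 * h - d - 1) - (0.223680789)| ≤ 0.00000038 :=
    near_mul hk5 hr2 (by norm_num [abs_of_nonneg, abs_of_nonpos])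
  obtain ⟨Z, eZ⟩ : ∃ Z,
    Z = -((a - (a - w) * (w * (1 + w) - a)) * (2 * h + a - 1)) - a * (1 + a - w) * (2 * h - d -
    1) := ⟨_, rfl⟩
  have hZ : |Z - (-0.087510011)| ≤ 0.000000692 :=
    abs_le.2 ⟨by linarith only [eZ, (abs_le.1 hk4).1, (abs_le.1 hk4).2, (abs_le.1 hk6).1,
      (abs_le.1 hk6).2],
      by linarith only [eZ, (abs_le.1 hk4).1, (abs_le.1 hk4).2, (abs_le.1 hk6).1, (abs_le.1 hk6).2]⟩
  have huv : |(w * w) * (w * (1 + w)) - (-0.050903778)| ≤ 0.000000063 :=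
    near_mul hu hv (by norm_num [abs_of_nonneg, abs_of_nonpos])
  obtain ⟨z, ez, hz⟩ : ∃ q, q * ((w * w) * (w * (1 + w))) = Z ∧ |q - (1.719126054)| ≤ 0.000015723 :=
    exists_near_div hZ huv (by norm_num [abs_of_nonneg, abs_of_nonpos])
      (by norm_num [abs_of_nonneg, abs_of_nonpos])
  have hone : |(1 : ℝ) - (1.0)| ≤ 0.0 := by norm_num
  obtain ⟨c₂, ec₂, hc2⟩ : ∃ q, q * z = (1 : ℝ) ∧ |q - (0.581690911)| ≤ 0.000005321 :=
    exists_near_div hone hz (by norm_num [abs_of_nonneg, abs_of_nonpos])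
      (by norm_num [abs_of_nonneg, abs_of_nonpos])
  have hx3 : |w * z - (-0.779150734)| ≤ 0.000007299 :=
    near_mul hw hz (by norm_num [abs_of_nonneg, abs_of_nonpos])
  have hKd : |(2 * h - d) - (-0.008209834)| ≤ 0.000000381 :=
    abs_le.2 ⟨by linarith only [(abs_le.1 hK).1, (abs_le.1 hK).2, (abs_le.1 hd).1, (abs_le.1 hd).2],
      by linarith only [(abs_le.1 hK).1, (abs_le.1 hK).2, (abs_le.1 hd).1, (abs_le.1 hd).2]⟩
  have hk7 : |d * (2 * h - d) - (-0.017031041)| ≤ 0.000000794 :=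
    near_mul hd hKd (by norm_num [abs_of_nonneg, abs_of_nonpos])
  obtain ⟨b, eb, hb⟩ : ∃ q, q * a = d * (2 * h - d) ∧ |q - (0.098250121)| ≤ 0.000004688 :=
    exists_near_div hk7 ha (by norm_num [abs_of_nonneg, abs_of_nonpos])
      (by norm_num [abs_of_nonneg, abs_of_nonpos])
  have hd2 : |(2 - d) - (-0.074468374)| ≤ 0.000000379 :=
    abs_le.2 ⟨by linarith only [(abs_le.1 hd).1, (abs_le.1 hd).2],
      by linarith only [(abs_le.1 hd).1, (abs_le.1 hd).2]⟩
  have hk8 : |w * (2 - d) - (0.033750921)| ≤ 0.00000018 :=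
    near_mul hw hd2 (by norm_num [abs_of_nonneg, abs_of_nonpos])
  obtain ⟨c₄, ec₄, hc4⟩ : ∃ q, q * a = w * (2 - d) ∧ |q - (-0.194705189)| ≤ 0.00000125 :=
    exists_near_div hk8 ha (by norm_num [abs_of_nonneg, abs_of_nonpos])
      (by norm_num [abs_of_nonneg, abs_of_nonpos])
  have hwc2 : |w * c₂ - (-0.263636805)| ≤ 0.00000247 :=
    near_mul hw hc2 (by norm_num [abs_of_nonneg, abs_of_nonpos])
  obtain ⟨α, eα⟩ : ∃ α, α = b - 1 - w * c₂ := ⟨_, rfl⟩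
  have hal : |α - (-0.638113074)| ≤ 0.000007158 :=
    abs_le.2 ⟨by linarith only [eα, (abs_le.1 hb).1, (abs_le.1 hb).2, (abs_le.1 hwc2).1,
      (abs_le.1 hwc2).2],
      by linarith only [eα, (abs_le.1 hb).1, (abs_le.1 hb).2, (abs_le.1 hwc2).1, (abs_le.1 hwc2).2]⟩
  have hs : |(1 - w) - (1.4532249)| ≤ 0.0000001 :=
    abs_le.2 ⟨by linarith only [(abs_le.1 hw).1, (abs_le.1 hw).2],
      by linarith only [(abs_le.1 hw).1, (abs_le.1 hw).2]⟩
  have hga : |t * (1 - w) - (1.414806416)| ≤ 0.000002797 :=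
    near_mul ht hs (by norm_num [abs_of_nonneg, abs_of_nonpos])
  have hxc2 : |x * c₂ - (-0.359213143)| ≤ 0.000003577 :=
    near_mul hx hc2 (by norm_num [abs_of_nonneg, abs_of_nonpos])
  have hxw : |x * w - (0.279881184)| ≤ 0.000000289 :=
    near_mul hx hw (by norm_num [abs_of_nonneg, abs_of_nonpos])
  have hxc4 : |x * c₄ - (0.120236816)| ≤ 0.00000087 :=
    near_mul hx hc4 (by norm_num [abs_of_nonneg, abs_of_nonpos])
  have hx3w : |(w * z) * w - (0.353130514)| ≤ 0.000003387 :=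
    near_mul hx3 hw (by norm_num [abs_of_nonneg, abs_of_nonpos])
  have hx3c4 : |(w * z) * c₄ - (0.151704691)| ≤ 0.000002396 :=
    near_mul hx3 hc4 (by norm_num [abs_of_nonneg, abs_of_nonpos])
  have hwc4 : |w * c₄ - (0.08824524)| ≤ 0.000000587 :=
    near_mul hw hc4 (by norm_num [abs_of_nonneg, abs_of_nonpos])
  have hw0 : w ≠ 0 := by
    rintro rfl
    norm_num at hw
  have hw1 : 1 + w ≠ 0 := by
    rintro h1
    rw [eq_neg_of_add_eq_zero_right h1] at hw
    norm_num at hw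
  have ha0 : a ≠ 0 := by
    rintro rfl
    norm_num at ha
  have hz0 : z ≠ 0 := by
    rintro rfl
    norm_num at ec₂
  have hhK : 2 - (2 - 2 * h / 2) * (2 - w - w ^ 2) = a := by
    rw [ea, em]
    ring
  have hhT : w * (w + 1) * (2 * h + a - 1) - a * (2 * (2 * h) - 2 - (2 - w - w ^ 2)) =
      t * (w * (1 + w)) := by
    rw [et, eT, em]
    ring
  have hhZ : -((a - (a - w) * (w ^ 2 + w - a)) * (2 * h + a - 1) +
      a * (1 + a - w) * (2 * h - d - 1)) = z * (w ^ 3 * (1 + w)) := by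
    linear_combination -ez - eZ
  have hdm : d = a + (2 - w - w ^ 2) := by rw [ed, em]; ring
  have hrel := relation_of_curve_eq_zero (b := b) hw0 hw1 ha0 hdm hhK hhT hhZ (by linear_combination eb)
    (by rwa [mul_div_cancel_left₀ h two_ne_zero])
  have exw : x * w = a - w := by linear_combination ex
  have hc₂z : z * c₂ = 1 := by linear_combination ec₂
  refine ⟨x, c₂, c₄, w * z, t, α, a, b, d, hw, ?_, ?_, ?_, ?_, ?_, ?_, ?_, ?_, ?_, ?_, hx, hc2,
    hc4, hx3, hga, hal, ha, hb, hd, hxc2, hxw, hxc4, hx3w, hx3c4, hwc2, hu, hwc4, hK⟩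
  · linear_combination -ex
  · linear_combination hdm - ex
  · refine mul_right_cancel₀ hw0 ?_
    linear_combination c₄ * ex + ec₄
  · linear_combination w * hc₂z
  · refine mul_left_cancel₀ (mul_ne_zero hw0 hw1) ?_
    linear_combination hhZ - (1 + x * w) * hhT + (w * (w + 1) * (2 * h + a - 1) -
      a * (2 * (2 * h) - 2 - (2 - w - w ^ 2))) * exw -
      a * (1 + a - w) * hdm
  · refine mul_left_cancel₀ (mul_ne_zero ha0 (mul_ne_zero hw0 hw1)) ?_
    linear_combination (2 - d) * hhZ + (a - x * w * (2 - d)) * hhT +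
      (w * (w + 1) * (2 * h + a - 1) - a * (2 * (2 * h) - 2 - (2 - w - w ^ 2))) * (2 - d) * exw +
      (t * w * (1 + w) * x - w * (1 + w) * w * z) * ec₄ +
      (a * (1 + a - w) * (d + a + (2 - w - w ^ 2) - 2 * h - 1) + a * w * (1 + w) -
        (a - (a - w) * (w ^ 2 + w - a)) * (2 * h + a - 1) -
        (w * (w + 1) * (2 * h + a - 1) - a * (2 * (2 * h) - 2 - (2 - w - w ^ 2))) * (a - w)) * hdm
  · refine mul_left_cancel₀ hz0 ?_
    linear_combination hrel + z * t * eα - t * w * hc₂z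
  · linear_combination eb
  · refine mul_left_cancel₀ ha0 ?_
    linear_combination (w - x) * ec₄ - (2 - d) * exw + eb + 2 * hhK +
      (2 * h - (w ^ 2 + w - a) - (d + a + (2 - w - w ^ 2))) * hdm
  · linear_combination -eα

end Construction

section Construction

/-- The matrix with the suit pattern that is determined by its parameters. -/
def suitMatrix (w x c₂ c₄ x₃ t α d : ℝ) : Matrix (Fin 5) (Fin 5) ℝ :=
  !![1, 1, c₂, w, c₄;
    x, 1 - w + x, α + x * c₂, -1, 1;
    -1, -w, α + d - c₂, -1, -1;
    x₃, t * (1 - w) + x₃, 1, 1, 1;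
    -w, -1, 1, -1, 1]

theorem elimStep_suitMatrix {w x c₂ c₄ x₃ t α d : ℝ} (hx₃ : x₃ * c₂ = w) :
    elimStep (suitMatrix w x c₂ c₄ x₃ t α d) =
      !![1 - w, α, -1 - x * w, 1 - x * c₄;
        1 - w, α + d, -(1 - w), -1 + c₄;
        t * (1 - w), 1 - w, 1 - x₃ * w, 1 - x₃ * c₄;
        -(1 - w), 1 + w * c₂, -1 + w * w, 1 + w * c₄] := by
  ext i j
  fin_cases i <;> fin_cases j <;> simp [elimStep, suitMatrix] <;> linarith

theorem elimStep_elimStep_suitMatrix {w h x c₂ c₄ x₃ t α a b d : ℝ}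
    (H : SuitParameters w h x c₂ c₄ x₃ t α a b d) :
    elimStep (elimStep (suitMatrix w x c₂ c₄ x₃ t α d)) =
      !![d, a, -d;
        d, 2 * h + a, 2 * h - d;
        b, -d, 2 * h - b] := by
  have hw := abs_le.1 H.near_w
  have hs : 1 - w ≠ 0 := by linarith
  have hn : (w - 1) / (1 - w) = -1 := by
    rw [div_eq_iff hs]
    ring
  have h1 := H.ha
  have h2 := H.hd
  have h3 := H.hc₄
  have h4 := H.h₁₁
  have h5 := H.h₁₂
  have h6 := H.h₀₀
  have h7 := H.h₂₂
  have h8 := H.hb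
  rw [elimStep_suitMatrix H.hx₃]
  clear H
  ext i j
  fin_cases i <;> fin_cases j <;> simp [elimStep, hs, hn, mul_div_right_comm] <;> linarith

theorem elimStep_elimStep_elimStep_suitMatrix {w h x c₂ c₄ x₃ t α a b d : ℝ}
    (H : SuitParameters w h x c₂ c₄ x₃ t α a b d) :
    elimStep (elimStep (elimStep (suitMatrix w x c₂ c₄ x₃ t α d))) =
      !![2 * h, 2 * h; -(2 * h), 2 * h] := by
  have hd := abs_le.1 H.near_d
  have hd : d ≠ 0 := by linarith
  have hab := H.hab
  rw [elimStep_elimStep_suitMatrix H]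
  clear H
  ext i j
  fin_cases i <;> fin_cases j <;> simp [elimStep, hd]
  all_goals
    field_simp
    linarith

theorem suitPattern_suitMatrix {w h x c₂ c₄ x₃ t α a b d : ℝ}
    (H : SuitParameters w h x c₂ c₄ x₃ t α a b d) :
    SuitPattern (suitMatrix w x c₂ c₄ x₃ t α d) := by
  constructor
  any_goals
    rw [elimStep_elimStep_elimStep_suitMatrix H]
    simp
  any_goals
    rw [elimStep_elimStep_suitMatrix H]
    simp
  any_goals
    rw [elimStep_suitMatrix H.hx₃]
    simp
  all_goals simp [suitMatrix]

theorem abs_suitMatrix_le {w h x c₂ c₄ x₃ t α a b d : ℝ}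
    (H : SuitParameters w h x c₂ c₄ x₃ t α a b d) (i j : Fin 5) :
    |suitMatrix w x c₂ c₄ x₃ t α d i j| ≤ |suitMatrix w x c₂ c₄ x₃ t α d 0 0| := by
  have h1 := abs_le.1 H.near_w
  have h2 := abs_le.1 H.near_x
  have h3 := abs_le.1 H.near_c2
  have h4 := abs_le.1 H.near_c4
  have h5 := abs_le.1 H.near_x3
  have h6 := abs_le.1 H.near_ga
  have h7 := abs_le.1 H.near_al
  have h8 := abs_le.1 H.near_d
  have h9 := abs_le.1 H.near_xc2
  clear H
  revert i j
  simp only [suitMatrix, Fin.forall_fin_succ, Matrix.of_apply, Matrix.cons_val_zero,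
    Matrix.cons_val_succ, IsEmpty.forall_iff, and_true, abs_neg, abs_one, le_refl, true_and]
  refine ⟨⟨?_, ?_, ?_⟩, ⟨?_, ?_, ?_⟩, ⟨?_, ?_⟩, ⟨?_, ?_⟩, ?_⟩ <;>
    exact abs_le.2 ⟨by linarith only [h1, h2, h3, h4, h5, h6, h7, h8, h9],
      by linarith only [h1, h2, h3, h4, h5, h6, h7, h8, h9]⟩

theorem abs_elimStep_suitMatrix_le {w h x c₂ c₄ x₃ t α a b d : ℝ}
    (H : SuitParameters w h x c₂ c₄ x₃ t α a b d) (i j : Fin 4) :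
    |elimStep (suitMatrix w x c₂ c₄ x₃ t α d) i j| ≤
      |elimStep (suitMatrix w x c₂ c₄ x₃ t α d) 0 0| := by
  have h1 := abs_le.1 H.near_w
  have h2 := abs_le.1 H.near_al
  have h3 := abs_le.1 H.near_xw
  have h4 := abs_le.1 H.near_xc4
  have h5 := abs_le.1 H.near_d
  have h6 := abs_le.1 H.near_c4
  have h7 := abs_le.1 H.near_ga
  have h8 := abs_le.1 H.near_x3w
  have h9 := abs_le.1 H.near_x3c4
  have h10 := abs_le.1 H.near_wc2
  have h11 := abs_le.1 H.near_u
  have h12 := abs_le.1 H.near_wc4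
  rw [elimStep_suitMatrix H.hx₃]
  clear H
  revert i j
  have hs : |1 - w| = 1 - w := abs_of_nonneg (by linarith only [h1])
  simp only [Fin.forall_fin_succ, Matrix.of_apply, Matrix.cons_val_zero,
    Matrix.cons_val_succ, IsEmpty.forall_iff, and_true, abs_neg, hs, le_refl, true_and]
  refine ⟨⟨?_, ?_, ?_⟩, ⟨?_, ?_⟩, ⟨?_, ?_, ?_⟩, ⟨?_, ?_, ?_⟩⟩ <;>
    exact abs_le.2 ⟨by linarith only [h1, h2, h3, h4, h5, h6, h7, h8, h9, h10, h11, h12],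
      by linarith only [h1, h2, h3, h4, h5, h6, h7, h8, h9, h10, h11, h12]⟩

theorem completelyPivoted_suitMatrix {w h x c₂ c₄ x₃ t α a b d : ℝ}
    (H : SuitParameters w h x c₂ c₄ x₃ t α a b d) :
    CompletelyPivoted (suitMatrix w x c₂ c₄ x₃ t α d) := by
  refine ⟨abs_suitMatrix_le H, abs_elimStep_suitMatrix_le H, ?_, ?_, ?_, trivial⟩
  · have h1 := abs_le.1 H.near_a
    have h2 := abs_le.1 H.near_b
    have h3 := abs_le.1 H.near_d
    have h4 := abs_le.1 H.near_K
    rw [elimStep_elimStep_suitMatrix H]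
    clear H
    have hs : |d| = d := abs_of_nonneg (by linarith only [h3])
    simp only [Fin.forall_fin_succ, Matrix.of_apply, Matrix.cons_val_zero,
      Matrix.cons_val_succ, IsEmpty.forall_iff, and_true, abs_neg, hs, le_refl, true_and]
    refine ⟨?_, ⟨?_, ?_⟩, ?_, ?_⟩ <;>
      exact abs_le.2 ⟨by linarith only [h1, h2, h3, h4], by linarith only [h1, h2, h3, h4]⟩
  · rw [elimStep_elimStep_elimStep_suitMatrix H]
    simp [Fin.forall_fin_succ]
  · intro i j
    rw [Fin.fin_one_eq_zero i, Fin.fin_one_eq_zero j]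

theorem last_pivot_suitMatrix {w h x c₂ c₄ x₃ t α a b d : ℝ}
    (H : SuitParameters w h x c₂ c₄ x₃ t α a b d) :
    elimStep (elimStep (elimStep (elimStep (suitMatrix w x c₂ c₄ x₃ t α d)))) 0 0 = 4 * h := by
  have h1 := abs_le.1 H.near_K
  have h0 : h ≠ 0 := by
    rintro rfl
    norm_num at h1
  rw [elimStep_elimStep_elimStep_suitMatrix H]
  simp only [elimStep, Matrix.of_apply, Fin.succ_zero_eq_one, Matrix.cons_val_zero,
    Matrix.cons_val_one, Matrix.cons_val']
  field_simp
  ring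

end Construction

section GrowthFactor

theorem abs_le_maxNorm {n : ℕ} (A : Matrix (Fin n) (Fin n) ℝ) (i j : Fin n) :
    |A i j| ≤ maxNorm A :=
  le_ciSup (f := fun p : Fin n × Fin n => |A p.1 p.2|) (Set.finite_range _).bddAbove (i, j)

theorem maxNorm_le {n : ℕ} {A : Matrix (Fin (n + 1)) (Fin (n + 1)) ℝ} {M : ℝ}
    (h : ∀ i j, |A i j| ≤ M) : maxNorm A ≤ M := ciSup_le fun p => h p.1 p.2

theorem CompletelyPivoted.maxNorm_eq {n : ℕ} {A : Matrix (Fin (n + 1)) (Fin (n + 1)) ℝ}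
    (hA : CompletelyPivoted A) : maxNorm A = |A 0 0| :=
  le_antisymm (maxNorm_le hA.abs_le) (abs_le_maxNorm A 0 0)

theorem CompletelyPivoted.abs_lowerFactor_le {n : ℕ} {A : Matrix (Fin n) (Fin n) ℝ}
    (hA : CompletelyPivoted A) (i j : Fin n) : |lowerFactor A i j| ≤ 1 := by
  induction n with
  | zero => exact i.elim0
  | succ n ih =>
    refine Fin.cases ?_ (fun i => ?_) i
    · refine Fin.cases ?_ (fun j => ?_) j
      · exact abs_one.le
      · exact abs_zero.trans_le zero_le_one
    · refine Fin.cases ?_ (fun j => ?_) j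
      · change |A i.succ 0 / A 0 0| ≤ 1
        rw [abs_div]
        exact div_le_one_of_le₀ (hA.abs_le _ _) (abs_nonneg _)
      · exact ih hA.elimStep i j

theorem CompletelyPivoted.abs_upperFactor_le {n : ℕ} {A : Matrix (Fin (n + 1)) (Fin (n + 1)) ℝ}
    (hA : CompletelyPivoted A) {M : ℝ} (h0 : |A 0 0| ≤ M)
    (h : ∀ i j, |upperFactor (_root_.elimStep A) i j| ≤ M) (i j : Fin (n + 1)) :
    |upperFactor A i j| ≤ M := by
  refine Fin.cases ?_ (fun i => ?_) i
  · exact (hA.abs_le 0 j).trans h0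
  · refine Fin.cases ?_ (fun j => ?_) j
    · exact abs_zero.trans_le ((abs_nonneg _).trans h0)
    · exact h i j

/-- If the fourth pivot of a completely pivoted matrix with the suit pattern is at most half of
`M ≥ 4`, then the growth factor is at most `M`. -/
theorem growthFactor_le {A : Matrix (Fin 5) (Fin 5) ℝ} (hA : CompletelyPivoted A)
    (hP : SuitPattern A) {M : ℝ} (hM : 4 ≤ M)
    (hK : 2 * |elimStep (elimStep (elimStep A)) 0 0| ≤ M) : growthFactor A ≤ M := by
  have hA2 := hA.elimStep
  have hA3 := hA2.elimStep
  have hA4 := hA3.elimStep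
  have hA5 := hA4.elimStep
  have h1 : |A 0 0| = 1 := by rw [hP.row1.1, abs_one]
  have h2 := hA.abs_elimStep_le
  have h3 := hA2.abs_elimStep_le
  have h5 := hA4.abs_elimStep_le
  rw [growthFactor, hA.maxNorm_eq, h1, div_one]
  refine max_le ((maxNorm_le hA.abs_lowerFactor_le).trans (by linarith)) (maxNorm_le ?_)
  refine hA.abs_upperFactor_le (by linarith) (hA2.abs_upperFactor_le (by linarith)
    (hA3.abs_upperFactor_le (by linarith) (hA4.abs_upperFactor_le ?_
      (hA5.abs_upperFactor_le (h5.trans hK) fun i => i.elim0))))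
  linarith [abs_nonneg (elimStep (elimStep (elimStep A)) 0 0)]

theorem last_pivot_le_growthFactor {A : Matrix (Fin 5) (Fin 5) ℝ} (hA : CompletelyPivoted A)
    (h1 : A 0 0 = 1) :
    elimStep (elimStep (elimStep (elimStep A))) 0 0 ≤ growthFactor A := by
  rw [growthFactor, hA.maxNorm_eq, h1, abs_one, div_one]
  exact (le_abs_self _).trans ((abs_le_maxNorm (upperFactor A) 4 4).trans (le_max_right _ _))

end GrowthFactor

theorem theorem2p1 :
    P5.natDegree = 61 ∧
    ∃ g : ℝ, g ∈ Set.Ioo (4 : ℝ) 5 ∧ Polynomial.aeval g P5 = 0 ∧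
      (∀ h ∈ Set.Ioo (4 : ℝ) 5, Polynomial.aeval h P5 = 0 → h = g) ∧
      4.1325170786 < g ∧ g < 4.1325170787 ∧
      IsGreatest
        {γ : ℝ | ∃ A : Matrix (Fin 5) (Fin 5) ℝ,
          CompletelyPivoted A ∧ SuitPattern A ∧ γ = growthFactor A} g := by
  obtain ⟨g, h1, h2, hg⟩ := exists_root_P5
  have hmem : g ∈ Set.Ioo (4 : ℝ) 5 := ⟨by linarith, by linarith⟩
  obtain ⟨w, hw1, hw2, hw, hw'⟩ := exists_critical h1 h2 hg
  have hg4 : g = 4 * (g / 4) := by ring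
  have hneg : ∀ w h, g / 4 < h → 2 * h ≤ 2 - w - w ^ 2 → curve w h < 0 := fun u h hh hu =>
    curve_neg_of_critical (w₀ := w) (h₀ := g / 4) ⟨by linarith, by linarith⟩
      ⟨by linarith, by linarith⟩ (by rwa [← hg4]) (by rwa [← hg4]) hh hu
  have hle : ∀ A : Matrix (Fin 5) (Fin 5) ℝ, CompletelyPivoted A → SuitPattern A →
      growthFactor A ≤ g := fun A hA hP => by
    have := abs_club_le hA hP (h₀ := g / 4) (by linarith) hneg
    exact growthFactor_le hA hP (by linarith) (by linarith)
  refine ⟨natDegree_P5, g, hmem, by rw [aeval_P5, hg], fun h hh h0 => ?_, h1, h2, ?_, ?_⟩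
  · rw [aeval_P5] at h0
    exact strictMonoOn_P5.injOn hh hmem (h0.trans hg.symm)
  · have hc : curve w (g / 4) = 0 := by
      have := evalLL_curveCoeffs w (g / 4)
      rw [← hg4, hw] at this
      linarith
    obtain ⟨x, c₂, c₄, x₃, t, α, a, b, d, H⟩ := exists_suitParameters (h := g / 4)
      (abs_le.2 ⟨by linarith, by linarith⟩) (abs_le.2 ⟨by linarith, by linarith⟩) hc
    have hA := completelyPivoted_suitMatrix H
    have hP := suitPattern_suitMatrix H
    refine ⟨suitMatrix w x c₂ c₄ x₃ t α d, hA, hP, le_antisymm ?_ (hle _ hA hP)⟩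
    rw [hg4, ← last_pivot_suitMatrix H]
    exact last_pivot_le_growthFactor hA hP.row1.1
  · rintro γ ⟨A, hA, hP, rfl⟩
    exact hle A hA hP
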